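/- Conventions. An ordered $r$-simplex $T=(e_0,\dots,e_r)$ is described by $x_0=e_0$ and its edge vectors $x_i=e_i-e_{i-1}$ $(1\le i\le r)$. For a permutation $\pi=(p_1,\dots,p_r)$ of $1,\dots,r$, the conjugate $T^\pi$ is the ordered simplex with vertices $x_0+\sum_{\nu\le i}x_{p_\nu}$ $(0\le i\le r)$. For $\sigma=(s_1,\dots,s_r)\in\{0,1\}^r$, $T_\sigma$ is the ordered simplex with first vertex $x_0+\frac12\sum_\nu s_\nu x_\nu$ and edge vectors $\frac12x_1,\dots,\frac12x_r$, and $\pi^\sigma$ is the permutation that lists first the $p_\nu$ with $s_{p_\nu}=1$ and then those with $s_{p_\nu}=0$, each group in the order of $\pi$. $Z(T)$ consists of the simplices $(T_\sigma)^\pi$ with $\pi^\sigma=\mathrm{id}$, and their faces. If $R$ is a simplicial complex with linearly ordered vertices, $Z(R)$ consists of all simplices of the $Z(T)$, where $T$ runs through the simplices of $R$ with their vertices in the given order. The vertices of $Z(R)$ are the midpoints of the pairs $(p,q)$, where either $p=q$ is a vertex of $R$, or $pq$ is an edge of $R$ with $p$ before $q$; they are ordered lexicographically by these pairs. Theorem.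 Let $R$ be a finite geometric simplicial complex in a real inner product space, with a linear order on its vertices, and let $R_0=R$, $R_{k+1}=Z(R_k)$. Then: 1. Each $R_k$ is (well defined and) a finite simplicial complex, its vertices are linearly ordered by the order above, and $R_{k+1}$ is a subdivision of $R_k$: every simplex of $R_{k+1}$ lies in a simplex of $R_k$, and every simplex of $R_k$ is the union of the simplices of $R_{k+1}$ that lie in it. 2. For every $k$, every simplex of $R_k$ is a face of a simplex $t$ of $R_k$ that lies in a simplex $T$ of $R$ with $\dim t=\dim T$. Whenever $t\in R_k$ lies in $T\in R$ and $\dim t=\dim T$, the simplex $t$, with its vertices in the order of $R_k$, is similar to a conjugate $T^\pi$ of $T$, with its vertices in the order of $R$. 3. There is a constant $C$, depending on $R$ and the vertex order but not on $k$, such that every simplex of every $R_k$, of any dimension $r$, has $r$-dimensional volume $v>0$ and diameter $c$ with $c^r/v\le C$. -/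

import Mathlib

open MeasureTheory

noncomputable section

namespace FreudenthalSubdivision

variable {E : Type*} [NormedAddCommGroup E] [InnerProductSpace ℝ E]

/-- The `ν`-th edge vector `x_ν = e_ν - e_{ν-1}` of the ordered simplex `T = (e_0, …, e_r)`. -/
def edgeVec {r : ℕ} (T : Fin (r + 1) → E) (ν : Fin r) : E :=
  T ν.succ - T ν.castSucc

/-- The conjugate `T^π` of the ordered simplex `T`: its `k`-th vertex is
`x_0 + x_{π 1} + ⋯ + x_{π k}`. -/
def conjugate {r : ℕ} (T : Fin (r + 1) → E) (π : Equiv.Perm (Fin r)) : Fin (r + 1) → E :=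
  fun k => T 0 + ∑ ν : Fin r with ν.castSucc < k, edgeVec T (π ν)

/-- The ordered simplex `T_σ` with first vertex `x_0 + (1/2) ∑ s_ν x_ν` and with edge vectors
`x_ν / 2`, for `σ = (s_1, …, s_r) ∈ {0,1}^r`. -/
def halfSimplex {r : ℕ} (T : Fin (r + 1) → E) (σ : Fin r → Fin 2) : Fin (r + 1) → E :=
  fun k => (T 0 + (1 / 2 : ℝ) • ∑ ν : Fin r, (σ ν : ℕ) • edgeVec T ν)
    + (1 / 2 : ℝ) • (T k - T 0)

/-- `IsStar π σ π'` says that `π' = π^σ`: in the list `π'` the indices `a` with `s_a = 1` come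
first and those with `s_a = 0` come last, and inside both groups the order of the list `π` is kept.
The index `a` is at the place `π.symm a` of the list `π 1, …, π r`. -/
def IsStar {r : ℕ} (π : Equiv.Perm (Fin r)) (σ : Fin r → Fin 2) (π' : Equiv.Perm (Fin r)) : Prop :=
  (∀ a b, σ b < σ a → π'.symm a < π'.symm b) ∧
  (∀ a b, σ a = σ b → π.symm a < π.symm b → π'.symm a < π'.symm b)

/-- The top-dimensional simplices of the subdivision `Z(T)` of a single ordered simplex `T`: the
ordered simplices `(T_σ)^π` for which `π^σ` is the identity permutation. -/
def cells {r : ℕ} (T : Fin (r + 1) → E) : Set (Fin (r + 1) → E) :=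
  {t | ∃ (σ : Fin r → Fin 2) (π : Equiv.Perm (Fin r)),
    IsStar π σ 1 ∧ t = conjugate (halfSimplex T σ) π}

/-- `T` lists the points of the finite set `s` in increasing order. -/
def Lists (lt : E → E → Prop) (s : Finset E) {r : ℕ} (T : Fin (r + 1) → E) : Prop :=
  (∀ i j, i < j → lt (T i) (T j)) ∧ Set.range T = (s : Set E)

/-- `lt` is a strict linear order on the set `V`. -/
def LinearOn (lt : E → E → Prop) (V : Set E) : Prop :=
  (∀ a ∈ V, ¬ lt a a) ∧
  (∀ a ∈ V, ∀ b ∈ V, ∀ c ∈ V, lt a b → lt b c → lt a c) ∧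
  (∀ a ∈ V, ∀ b ∈ V, a ≠ b → lt a b ∨ lt b a)

variable (E) in
/-- A set of simplices, each given by its finite set of vertices, with a relation that is meant to
order the vertices. This is only the data on which the process `Z` acts. -/
structure OrderedFaces where
  faces : Set (Finset E)
  lt : E → E → Prop

/-- `(p, q)` is a vertex (`p = q`) or an edge with `p` before `q`. -/
def OrderedFaces.IsEdge (K : OrderedFaces E) (p q : E) : Prop :=
  (∃ s ∈ K.faces, (s : Set E) = {p, q}) ∧ (p = q ∨ K.lt p q)

/-- The process `Z`. The new simplices are the faces of the cells of `Z(T)`, where `T` runs through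
the old simplices, listed in order. The new vertices are the midpoints of the pairs `(p, q)` with
`p = q` a vertex or `pq` an edge, `p` before `q`; they are ordered lexicographically by these
pairs. -/
def Z (K : OrderedFaces E) : OrderedFaces E where
  faces := {s | s.Nonempty ∧ ∃ S ∈ K.faces, ∃ (r : ℕ) (T : Fin (r + 1) → E),
    Lists K.lt S T ∧ ∃ t ∈ cells T, (s : Set E) ⊆ Set.range t}
  lt := fun m m' => ∃ p q p' q' : E, K.IsEdge p q ∧ K.IsEdge p' q' ∧
    m = midpoint ℝ p q ∧ m' = midpoint ℝ p' q' ∧ (K.lt p p' ∨ (p = p' ∧ K.lt q q'))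

/-- `K'` is a subdivision of `K`: every simplex of `K'` lies in a simplex of `K`, and every simplex
of `K` is the union of the simplices of `K'` that lie in it. -/
def IsSubdivision (K' K : Geometry.SimplicialComplex ℝ E) : Prop :=
  (∀ s ∈ K'.faces, ∃ S ∈ K.faces, convexHull ℝ (s : Set E) ⊆ convexHull ℝ (S : Set E)) ∧
  (∀ S ∈ K.faces, convexHull ℝ (S : Set E) =
    ⋃ s ∈ {s ∈ K'.faces | convexHull ℝ (s : Set E) ⊆ convexHull ℝ (S : Set E)},
      convexHull ℝ (s : Set E))

/-- The simplex `s`, with its vertices in the order `lt'`, is similar to some conjugate of the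
simplex `S`, with its vertices in the order `lt`. -/
def SimilarToConjugate (lt' : E → E → Prop) (s : Finset E) (lt : E → E → Prop) (S : Finset E) :
    Prop :=
  ∃ (r : ℕ) (t T : Fin (r + 1) → E) (π : Equiv.Perm (Fin r)),
    Lists lt' s t ∧ Lists lt S T ∧ Similar t (conjugate T π)

/-- The `r`-dimensional volume of the convex hull of `s`. -/
def simplexVolume [MeasurableSpace E] [BorelSpace E] (r : ℕ) (s : Finset E) : ℝ :=
  (μHE[r] (convexHull ℝ (s : Set E))).toReal

/-- The diameter of the convex hull of `s`. -/
def simplexDiam (s : Finset E) : ℝ :=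
  Metric.diam (convexHull ℝ (s : Set E))

end FreudenthalSubdivision

end

/-!
The vertices of a cell `(T_σ)^π` with `π^σ = id` are midpoints of pairs `(T i, T j)` with `i ≤ j`,
and along the cell the pairs `(i, j)` form a chain for the product order in which, moreover, every
first entry is at most every second entry (`exists_path_of_mem_cells`).

The cells cover `T`: with respect to the edge vectors a point of `T` has decreasing coordinates in
`[0, 1]`; those that are at least `1 / 2` give `σ`, and a stable sorting of the remainders of the
doubled coordinates gives `π` (`exists_cell_of_mem_convexHull`).

The cells of all the simplices of a complex fit together. A downward closed family of nonempty
finite sets is a simplicial complex as soon as a point has at most one system of barycentric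
coordinates with support in the family (`complexOfUniqueWeights`). A convex combination of midpoints
along a chain of pairs gives, by passing to the marginal of its weights, the barycentric coordinates
in the old complex. Conversely the marginal determines the weights (`IsChainWeight.ext`): the first
entries carry the lower half of its mass and the second entries the upper half, and weights on a
chain are the monotone coupling of the distributions of the first and the second entries.

The edge vectors of a cell of `T` are halves of the edge vectors of `T` in another order. Hence, by
induction, a simplex of `R_k` of full dimension in a simplex `S` of `R` is a translate of a
conjugate of `S` scaled by `2⁻ᵏ` (`IsIteration.exists_eq_add_smul_conjugate`). So all the simplices
that occur are, up to translations and homotheties, faces of the finitely many conjugates of the simplices of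
`R`, and these maps do not change the flatness (`IsIteration.exists_flatness_le`).
-/

namespace FreudenthalSubdivision

/-! ### Weights on a chain of pairs -/

/-- A probability weight `a` on the finite set `P` whose support, read through the two coordinates
`i` and `j`, is a chain for the product order on which every first coordinate is at most every
second coordinate. -/
structure IsChainWeight {ι α : Type*} [LinearOrder α] (P : Finset ι) (i j : ι → α) (a : ι → ℝ) :
    Prop where
  nonneg : ∀ x ∈ P, 0 ≤ a x
  sum_eq_one : ∑ x ∈ P, a x = 1
  chain : ∀ x ∈ P, ∀ y ∈ P, a x ≠ 0 → a y ≠ 0 → (i x ≤ i y ∧ j x ≤ j y) ∨ (i y ≤ i x ∧ j y ≤ j x)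
  fst_le_snd : ∀ x ∈ P, ∀ y ∈ P, a x ≠ 0 → a y ≠ 0 → i x ≤ j y

namespace IsChainWeight

variable {ι α : Type*} [LinearOrder α] {P : Finset ι} {i j : ι → α} {a b : ι → ℝ}

/-- The two marginals can be read off from their sum, since the mass of the first one lies before
the mass of the second one. -/
theorem sum_fst_eq_min (ha : IsChainWeight P i j a) (c : α) :
    ∑ x ∈ P with i x ≤ c, a x =
      min (∑ x ∈ P with i x ≤ c, a x + ∑ x ∈ P with j x ≤ c, a x) 1 := by
  have h1 : ∑ x ∈ P with i x ≤ c, a x ≤ 1 := by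
    rw [← ha.sum_eq_one]
    exact Finset.sum_le_sum_of_subset_of_nonneg (Finset.filter_subset _ _)
      fun x hx _ => ha.nonneg x hx
  have h2 : 0 ≤ ∑ x ∈ P with j x ≤ c, a x :=
    Finset.sum_nonneg fun x hx => ha.nonneg x (Finset.mem_filter.1 hx).1
  by_cases h : ∃ x ∈ P, a x ≠ 0 ∧ c < i x
  · obtain ⟨x, hx, hax, hcx⟩ := h
    have : ∑ x ∈ P with j x ≤ c, a x = 0 := by
      refine Finset.sum_eq_zero fun y hy => ?_
      rw [Finset.mem_filter] at hy
      by_contra hay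
      exact absurd (hcx.trans_le ((ha.fst_le_snd x hx y hy.1 hax hay).trans hy.2)) (lt_irrefl _)
    rw [this, add_zero, min_eq_left h1]
  · push Not at h
    have : ∑ x ∈ P with i x ≤ c, a x = 1 := by
      rw [← ha.sum_eq_one]
      refine Finset.sum_filter_of_ne fun x hx hax => h x hx hax
    rw [this, min_eq_right (by linarith)]

/-- A weight on a chain is the monotone coupling of its two marginals. -/
theorem sum_fst_snd_eq_min (ha : IsChainWeight P i j a) (c d : α) :
    ∑ x ∈ P with i x ≤ c ∧ j x ≤ d, a x =
      min (∑ x ∈ P with i x ≤ c, a x) (∑ x ∈ P with j x ≤ d, a x) := by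
  have h1 : ∑ x ∈ P with i x ≤ c ∧ j x ≤ d, a x ≤ ∑ x ∈ P with i x ≤ c, a x :=
    Finset.sum_le_sum_of_subset_of_nonneg
      (fun x hx => by simp only [Finset.mem_filter] at hx ⊢; exact ⟨hx.1, hx.2.1⟩)
      fun x hx _ => ha.nonneg x (Finset.mem_filter.1 hx).1
  have h2 : ∑ x ∈ P with i x ≤ c ∧ j x ≤ d, a x ≤ ∑ x ∈ P with j x ≤ d, a x :=
    Finset.sum_le_sum_of_subset_of_nonneg
      (fun x hx => by simp only [Finset.mem_filter] at hx ⊢; exact ⟨hx.1, hx.2.2⟩)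
      fun x hx _ => ha.nonneg x (Finset.mem_filter.1 hx).1
  by_cases h : ∃ x ∈ P, a x ≠ 0 ∧ i x ≤ c ∧ d < j x
  · obtain ⟨x, hx, hax, hxc, hxd⟩ := h
    have h3 : ∑ x ∈ P with i x ≤ c ∧ j x ≤ d, a x = ∑ x ∈ P with j x ≤ d, a x := by
      rw [Finset.sum_filter, Finset.sum_filter]
      refine Finset.sum_congr rfl fun y hy => ?_
      by_cases hay : a y = 0
      · simp [hay]
      have hyc : j y ≤ d → i y ≤ c := fun hyd => by
        rcases ha.chain x hx y hy hax hay with h | h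
        · exact absurd (hxd.trans_le (h.2.trans hyd)) (lt_irrefl _)
        · exact h.1.trans hxc
      exact if_congr ⟨fun h => h.2, fun h => ⟨hyc h, h⟩⟩ rfl rfl
    rw [h3] at h1 ⊢
    rw [min_eq_right h1]
  · push Not at h
    have h3 : ∑ x ∈ P with i x ≤ c ∧ j x ≤ d, a x = ∑ x ∈ P with i x ≤ c, a x := by
      rw [Finset.sum_filter, Finset.sum_filter]
      refine Finset.sum_congr rfl fun y hy => ?_
      by_cases hay : a y = 0
      · simp [hay]
      exact if_congr ⟨fun h => h.1, fun h' => ⟨h', h y hy hay h'⟩⟩ rfl rfl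
    rw [h3] at h2 ⊢
    rw [min_eq_left h2]

/-- A weight on a chain is determined by the sum of its two marginals. -/
theorem ext (hinj : ∀ x ∈ P, ∀ y ∈ P, i x = i y → j x = j y → x = y)
    (ha : IsChainWeight P i j a) (hb : IsChainWeight P i j b)
    (h : ∀ c, ∑ x ∈ P with i x ≤ c, a x + ∑ x ∈ P with j x ≤ c, a x =
      ∑ x ∈ P with i x ≤ c, b x + ∑ x ∈ P with j x ≤ c, b x) :
    ∀ x ∈ P, a x = b x := by
  have h1 (c : α) : ∑ x ∈ P with i x ≤ c, a x = ∑ x ∈ P with i x ≤ c, b x := by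
    rw [ha.sum_fst_eq_min, hb.sum_fst_eq_min, h]
  have h2 (c : α) : ∑ x ∈ P with j x ≤ c, a x = ∑ x ∈ P with j x ≤ c, b x := by
    linarith [h c, h1 c]
  have h3 (c d : α) : ∑ x ∈ P with i x ≤ c ∧ j x ≤ d, a x =
      ∑ x ∈ P with i x ≤ c ∧ j x ≤ d, b x := by
    rw [ha.sum_fst_snd_eq_min, hb.sum_fst_snd_eq_min, h1, h2]
  classical
  by_contra! hne
  obtain ⟨x₀, hx₀, hne₀⟩ := hne
  -- compare the two masses of the lower quadrant at a minimal place where the weights differ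
  obtain ⟨x, hx, hmin⟩ := Finset.exists_minimalFor (fun x => (i x, j x)) {x ∈ P | a x ≠ b x}
    ⟨x₀, by simp [hx₀, hne₀]⟩
  simp only [Finset.mem_filter] at hx hmin
  have hmem : x ∈ {y ∈ P | i y ≤ i x ∧ j y ≤ j x} := by simp [hx.1]
  have h4 := h3 (i x) (j x)
  rw [← Finset.add_sum_erase _ _ hmem, ← Finset.add_sum_erase _ _ hmem] at h4
  have h5 : ∑ y ∈ {y ∈ P | i y ≤ i x ∧ j y ≤ j x}.erase x, a y =
      ∑ y ∈ {y ∈ P | i y ≤ i x ∧ j y ≤ j x}.erase x, b y := by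
    refine Finset.sum_congr rfl fun y hy => ?_
    rw [Finset.mem_erase, Finset.mem_filter] at hy
    by_contra hab
    have := hmin ⟨hy.2.1, hab⟩ (Prod.mk_le_mk.2 hy.2.2)
    exact hy.1 (hinj y hy.2.1 x hx.1 (le_antisymm hy.2.2.1 this.1) (le_antisymm hy.2.2.2 this.2))
  exact hx.2 (by linarith)

end IsChainWeight

variable {E : Type*} [NormedAddCommGroup E]

/-! ### Ordered simplices and their cells -/

theorem eq_add_sum_edgeVec {r : ℕ} (T : Fin (r + 1) → E) (k : Fin (r + 1)) :
    T k = T 0 + ∑ ν : Fin r with ν.castSucc < k, edgeVec T ν := by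
  induction k using Fin.induction with
  | zero => simp
  | succ k ih =>
    have : (Finset.univ.filter fun ν : Fin r => ν.castSucc < k.succ) =
        insert k (Finset.univ.filter fun ν : Fin r => ν.castSucc < k.castSucc) := by
      ext ν
      simp only [Finset.mem_filter, Finset.mem_univ, true_and, Finset.mem_insert, Fin.lt_def,
        Fin.ext_iff, Fin.val_succ, Fin.val_castSucc]
      omega
    rw [this, Finset.sum_insert (by simp), add_left_comm, ← ih, edgeVec]
    abel

theorem conjugate_zero {r : ℕ} (T : Fin (r + 1) → E) (π : Equiv.Perm (Fin r)) :
    conjugate T π 0 = T 0 := by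
  simp [conjugate]

theorem edgeVec_conjugate {r : ℕ} (T : Fin (r + 1) → E) (π : Equiv.Perm (Fin r)) (ν : Fin r) :
    edgeVec (conjugate T π) ν = edgeVec T (π ν) := by
  have : (Finset.univ.filter fun μ : Fin r => μ.castSucc < ν.succ) =
      insert ν (Finset.univ.filter fun μ : Fin r => μ.castSucc < ν.castSucc) := by
    ext μ
    simp only [Finset.mem_filter, Finset.mem_univ, true_and, Finset.mem_insert, Fin.lt_def,
      Fin.ext_iff, Fin.val_succ, Fin.val_castSucc]
    omega
  rw [edgeVec, conjugate, conjugate, this, Finset.sum_insert (by simp)]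
  abel

/-- A lower set of `{0, …, r - 1}` is an initial segment, so the sum of its edge vectors leads from
the first vertex to another one. -/
theorem eq_add_sum_edgeVec_of_isLowerSet {r : ℕ} (T : Fin (r + 1) → E) {A : Finset (Fin r)}
    (hA : IsLowerSet (A : Set (Fin r))) (k : Fin (r + 1)) (hk : (k : ℕ) = A.card) :
    T k = T 0 + ∑ ν ∈ A, edgeVec T ν := by
  rw [eq_add_sum_edgeVec T k]
  congr 2
  ext ν
  have h := Fin.lt_card_filter_univ_iff_apply_of_imp (j := ν) (· ∈ A)
    (fun i j hij hj => hA hij hj)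
  simp only [Finset.filter_mem_eq_inter, Finset.univ_inter] at h
  simp [Fin.lt_def, hk, h]

variable [InnerProductSpace ℝ E]

theorem edgeVec_halfSimplex {r : ℕ} (T : Fin (r + 1) → E) (σ : Fin r → Fin 2) (ν : Fin r) :
    edgeVec (halfSimplex T σ) ν = (1 / 2 : ℝ) • edgeVec T ν := by
  simp only [edgeVec, halfSimplex]
  module

theorem halfSimplex_zero {r : ℕ} (T : Fin (r + 1) → E) (σ : Fin r → Fin 2) :
    halfSimplex T σ 0 = T 0 + (1 / 2 : ℝ) • ∑ ν : Fin r with σ ν = 1, edgeVec T ν := by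
  have h (ν : Fin r) : (σ ν : ℕ) • edgeVec T ν = if σ ν = 1 then edgeVec T ν else 0 := by
    rcases Fin.exists_fin_two.1 ⟨σ ν, rfl⟩ with h | h <;> simp [h]
  simp [halfSimplex, h, Finset.sum_filter]

theorem conjugate_halfSimplex_apply {r : ℕ} (T : Fin (r + 1) → E) (σ : Fin r → Fin 2)
    (π : Equiv.Perm (Fin r)) (m : Fin (r + 1)) :
    conjugate (halfSimplex T σ) π m =
      T 0 + (1 / 2 : ℝ) • (∑ ν : Fin r with σ ν = 1, edgeVec T ν +
        ∑ ν : Fin r with (π.symm ν).castSucc < m, edgeVec T ν) := by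
  rw [conjugate, halfSimplex_zero, smul_add, add_assoc]
  simp only [edgeVec_halfSimplex, ← Finset.smul_sum]
  congr 3
  exact Finset.sum_equiv π (by simp) (by simp)

/-- The vertices of a cell are the midpoints along a monotone lattice path of pairs of vertices,
all of whose first entries are at most all of its second entries. -/
theorem exists_path_of_mem_cells {r : ℕ} {T t : Fin (r + 1) → E} (ht : t ∈ cells T) :
    ∃ i j : Fin (r + 1) → Fin (r + 1), Monotone i ∧ Monotone j ∧ (∀ m n, i m ≤ j n) ∧
      (∀ m n, m < n → i m < i n ∨ i m = i n ∧ j m < j n) ∧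
      ∀ m, t m = midpoint ℝ (T (i m)) (T (j m)) := by
  obtain ⟨σ, π, hs, rfl⟩ := ht
  obtain ⟨hs1, hs2⟩ := hs
  simp only [Equiv.Perm.one_def, Equiv.refl_symm, Equiv.refl_apply] at hs1 hs2
  let A (m : Fin (r + 1)) : Finset (Fin r) := {ν | σ ν = 1 ∧ (π.symm ν).castSucc < m}
  let B (m : Fin (r + 1)) : Finset (Fin r) := {ν | σ ν = 1 ∨ (π.symm ν).castSucc < m}
  have hσ (a b) (hab : a < b) (hb : σ b = 1) : σ a = 1 := by
    by_contra ha
    have := hs1 b a (by rw [hb]; omega)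
    exact lt_asymm hab this
  have hπ (a b) (hab : a < b) (h : σ a = σ b) : π.symm a < π.symm b := by
    refine lt_of_le_of_ne (not_lt.1 fun h' => lt_asymm hab (hs2 b a h.symm h')) fun h' => ?_
    exact hab.ne (π.symm.injective h')
  have hA (m) : IsLowerSet (A m : Set (Fin r)) := by
    intro b a hab hb
    rcases hab.eq_or_lt with rfl | hab
    · exact hb
    simp only [A, Finset.coe_filter, Finset.mem_univ, true_and, Set.mem_ofPred_eq] at hb ⊢
    have ha := hσ a b hab hb.1
    exact ⟨ha, lt_trans (Fin.castSucc_lt_castSucc_iff.2 (hπ a b hab (ha.trans hb.1.symm))) hb.2⟩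
  have hB (m) : IsLowerSet (B m : Set (Fin r)) := by
    intro b a hab hb
    rcases hab.eq_or_lt with rfl | hab
    · exact hb
    simp only [B, Finset.coe_filter, Finset.mem_univ, true_and, Set.mem_ofPred_eq] at hb ⊢
    by_cases ha : σ a = 1
    · exact Or.inl ha
    by_cases hb' : σ b = 1
    · exact absurd (hσ a b hab hb') ha
    refine Or.inr (lt_trans (Fin.castSucc_lt_castSucc_iff.2 (hπ a b hab (by omega))) ?_)
    exact hb.resolve_left hb'
  have hcard (C : Finset (Fin r)) : C.card < r + 1 := by
    have := C.card_le_univ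
    simp at this
    omega
  have hAmono : Monotone A := fun m n hmn ν hν => by
    simp only [A, Finset.mem_filter, Finset.mem_univ, true_and] at hν ⊢
    exact ⟨hν.1, hν.2.trans_le hmn⟩
  have hBmono : Monotone B := fun m n hmn ν hν => by
    simp only [B, Finset.mem_filter, Finset.mem_univ, true_and] at hν ⊢
    exact hν.imp id fun h => h.trans_le hmn
  refine ⟨fun m => ⟨(A m).card, hcard _⟩, fun m => ⟨(B m).card, hcard _⟩,
    fun m n hmn => Finset.card_le_card (hAmono hmn),
    fun m n hmn => Finset.card_le_card (hBmono hmn),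
    fun m n => Fin.mk_le_mk.2 (Finset.card_le_card fun ν hν => ?_), fun m n hmn => ?_, fun m => ?_⟩
  · simp only [A, B, Finset.mem_filter, Finset.mem_univ, true_and] at hν ⊢
    exact Or.inl hν.1
  · -- the step at `m` adds the index `π m` to exactly one of the two sets
    obtain ⟨m, rfl⟩ := Fin.exists_castSucc_eq.2 (Fin.ne_last_of_lt hmn)
    by_cases h : σ (π m) = 1
    · refine Or.inl (Finset.card_lt_card ((Finset.ssubset_iff_of_subset (hAmono hmn.le)).2
        ⟨π m, ?_, ?_⟩)) <;> simp [A, h, hmn]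
    · have hlt : (B m.castSucc).card < (B n).card :=
        Finset.card_lt_card ((Finset.ssubset_iff_of_subset (hBmono hmn.le)).2
          ⟨π m, by simp [B, hmn], by simp [B, h]⟩)
      rcases (Finset.card_le_card (hAmono hmn.le)).lt_or_eq with h' | h'
      · exact Or.inl h'
      · exact Or.inr ⟨Fin.ext h', hlt⟩
  · rw [eq_add_sum_edgeVec_of_isLowerSet T (hA m) ⟨_, hcard _⟩ rfl,
      eq_add_sum_edgeVec_of_isLowerSet T (hB m) ⟨_, hcard _⟩ rfl, conjugate_halfSimplex_apply,
      midpoint_eq_smul_add]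
    have : ∑ ν : Fin r with σ ν = 1, edgeVec T ν +
        ∑ ν : Fin r with (π.symm ν).castSucc < m, edgeVec T ν =
        ∑ ν ∈ A m, edgeVec T ν + ∑ ν ∈ B m, edgeVec T ν := by
      rw [← Finset.sum_union_inter, add_comm]
      congr 2 <;> ext ν <;> simp [A, B]
    rw [this, invOf_eq_inv]
    module

/-! ### Coordinates with respect to the edge vectors -/

theorem sum_smul_eq_add_sum_edgeVec {ι : Type*} [Fintype ι] {r : ℕ} (T : Fin (r + 1) → E)
    (f : ι → Fin (r + 1)) (w : ι → ℝ) (hw : ∑ i, w i = 1) :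
    ∑ i, w i • T (f i) =
      T 0 + ∑ ν : Fin r, (∑ i with ν.castSucc < f i, w i) • edgeVec T ν := by
  calc ∑ i, w i • T (f i)
      = ∑ i, (w i • T 0 + ∑ ν : Fin r, if ν.castSucc < f i then w i • edgeVec T ν else 0) := by
        refine Finset.sum_congr rfl fun i _ => ?_
        rw [eq_add_sum_edgeVec T (f i), smul_add, Finset.smul_sum, Finset.sum_filter]
    _ = _ := by
        rw [Finset.sum_add_distrib, ← Finset.sum_smul, hw, one_smul, Finset.sum_comm]
        simp only [Finset.sum_filter, Finset.sum_smul, ite_smul, zero_smul]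

/-- The coordinates of a point of an ordered simplex with respect to the edge vectors form a
decreasing sequence in `[0, 1]`. -/
theorem exists_antitone_of_mem_convexHull {r : ℕ} {T : Fin (r + 1) → E} {x : E}
    (hx : x ∈ convexHull ℝ (Set.range T)) :
    ∃ c : Fin r → ℝ, Antitone c ∧ (∀ ν, 0 ≤ c ν) ∧ (∀ ν, c ν ≤ 1) ∧
      x = T 0 + ∑ ν, c ν • edgeVec T ν := by
  obtain ⟨ι, _, w, z, hw0, hw1, hz, rfl⟩ := mem_convexHull_iff_exists_fintype.1 hx
  choose f hf using hz
  obtain rfl : (fun i => T (f i)) = z := funext hf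
  refine ⟨fun ν => ∑ i with ν.castSucc < f i, w i, fun μ ν hμν => ?_,
    fun ν => Finset.sum_nonneg fun i _ => hw0 i, fun ν => ?_, sum_smul_eq_add_sum_edgeVec T f w hw1⟩
  · refine Finset.sum_le_sum_of_subset_of_nonneg (fun i hi => ?_) fun i _ _ => hw0 i
    simp only [Finset.mem_filter, Finset.mem_univ, true_and] at hi ⊢
    exact lt_of_le_of_lt (Fin.castSucc_le_castSucc_iff.2 hμν) hi
  · rw [← hw1]
    exact Finset.sum_le_sum_of_subset_of_nonneg (Finset.filter_subset _ _) fun i _ _ => hw0 i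

theorem mem_convexHull_of_antitone {r : ℕ} (T : Fin (r + 1) → E) {c : Fin r → ℝ} (hc : Antitone c)
    (h0 : ∀ ν, 0 ≤ c ν) (h1 : ∀ ν, c ν ≤ 1) :
    T 0 + ∑ ν, c ν • edgeVec T ν ∈ convexHull ℝ (Set.range T) := by
  -- the weights are the decrements of the sequence `1, c 0, …, c (r - 1), 0`
  let d (n : ℕ) : ℝ := if n = 0 then 1 else if h : n - 1 < r then c ⟨n - 1, h⟩ else 0
  have hd : ∀ n, d (n + 1) ≤ d n := by
    intro n
    rcases n with _ | n
    · simp only [d]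
      split_ifs <;> simp_all
    · simp only [d, Nat.add_one_ne_zero, if_false, Nat.add_sub_cancel]
      split_ifs with h h' h'
      · exact hc (by simp)
      · omega
      · exact h0 _
      · exact le_rfl
  have htail (n : ℕ) (hn : n ≤ r + 1) :
      ∑ i : Fin (r + 1) with n ≤ i.1, (d i - d (i + 1)) = d n := by
    have hlast : d (r + 1) = 0 := by simp [d]
    calc ∑ i : Fin (r + 1) with n ≤ i.1, (d i - d (i + 1))
        = ∑ i ∈ Finset.Ico n (r + 1), (d i - d (i + 1)) := by
          rw [Finset.sum_filter,
            Fin.sum_univ_eq_sum_range (fun i => if n ≤ i then d i - d (i + 1) else 0),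
            ← Finset.sum_filter]
          congr 1
          ext i
          simp only [Finset.mem_filter, Finset.mem_range, Finset.mem_Ico]
          omega
      _ = d n := by
          rw [← neg_inj, ← Finset.sum_neg_distrib]
          simp only [neg_sub]
          rw [Finset.sum_Ico_sub d hn, hlast, zero_sub]
  have hsum : ∑ i : Fin (r + 1), (d i - d (i + 1)) = 1 := by
    simpa [d] using htail 0 (Nat.zero_le _)
  have hval : T 0 + ∑ ν, c ν • edgeVec T ν = ∑ i : Fin (r + 1), (d i - d (i + 1)) • T i := by
    refine Eq.trans ?_ (sum_smul_eq_add_sum_edgeVec T id _ hsum).symm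
    congr 1
    refine Finset.sum_congr rfl fun ν _ => ?_
    congr 1
    have := htail (ν + 1) (by omega)
    rw [show d (ν + 1) = c ν by simp [d]] at this
    rw [← this]
    congr 1
  rw [hval]
  exact mem_convexHull_of_exists_fintype _ T (fun i => sub_nonneg.2 (hd i)) hsum
    (fun i => Set.mem_range_self i) rfl

/-- The cells of an ordered simplex cover it: the coordinates that are at least `1 / 2` give
`σ`, and a stable sorting of the remainders of the doubled coordinates gives `π`. -/
theorem exists_cell_of_mem_convexHull {r : ℕ} {T : Fin (r + 1) → E} {x : E}
    (hx : x ∈ convexHull ℝ (Set.range T)) :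
    ∃ t ∈ cells T, x ∈ convexHull ℝ (Set.range t) := by
  obtain ⟨c, hc, h0, h1, rfl⟩ := exists_antitone_of_mem_convexHull hx
  let σ (ν : Fin r) : Fin 2 := if 1 / 2 ≤ c ν then 1 else 0
  let u (ν : Fin r) : ℝ := if 1 / 2 ≤ c ν then 2 * c ν - 1 else 2 * c ν
  let π : Equiv.Perm (Fin r) := Tuple.sort fun ν => -u ν
  obtain ⟨hmono, hties⟩ := Tuple.eq_sort_iff.1 (rfl : π = Tuple.sort fun ν => -u ν)
  have hu (a b) (hab : a ≤ b) (h : σ a = σ b) : u b ≤ u a := by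
    have := hc hab
    simp only [σ, u] at h ⊢
    split_ifs at h ⊢ <;> first | linarith | simp at h
  refine ⟨_, ⟨σ, π, ⟨fun a b hab => ?_, fun a b hab h => ?_⟩, rfl⟩, ?_⟩
  · simp only [Equiv.Perm.one_def, Equiv.refl_symm, Equiv.refl_apply]
    by_contra! hba
    have := hc hba
    simp only [σ] at hab
    split_ifs at hab <;> first | linarith | simp at hab
  · simp only [Equiv.Perm.one_def, Equiv.refl_symm, Equiv.refl_apply]
    by_contra! hba
    have h2 := hu b a hba hab.symm
    have h3 := hmono h.le
    simp only [Function.comp_apply, Equiv.apply_symm_apply] at h3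
    have h4 := hties _ _ h (by simp only [Equiv.apply_symm_apply]; linarith)
    simp only [Equiv.apply_symm_apply] at h4
    exact absurd hba (not_le.2 h4)
  · have hval : T 0 + ∑ ν, c ν • edgeVec T ν = conjugate (halfSimplex T σ) π 0 +
        ∑ ν, u (π ν) • edgeVec (conjugate (halfSimplex T σ) π) ν := by
      simp only [conjugate_zero, edgeVec_conjugate, edgeVec_halfSimplex, halfSimplex_zero]
      rw [Equiv.sum_comp π fun ν => u ν • (1 / 2 : ℝ) • edgeVec T ν, Finset.sum_filter,
        Finset.smul_sum, add_assoc, ← Finset.sum_add_distrib]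
      congr 1
      refine Finset.sum_congr rfl fun ν _ => ?_
      by_cases h : 1 / 2 ≤ c ν
      · simp only [σ, u, if_pos h, if_true]
        module
      · simp only [σ, u, if_neg h, zero_ne_one, if_false]
        module
    rw [hval]
    refine mem_convexHull_of_antitone _ (fun a b hab => ?_) (fun ν => ?_) fun ν => ?_
    · have := hmono hab
      simp only [Function.comp_apply] at this
      linarith
    · have := h0 (π ν)
      simp only [u]
      split_ifs <;> linarith
    · have := h1 (π ν)
      simp only [u]
      split_ifs <;> linarith

/-! ### Barycentric weights -/

/-- `w` is a system of barycentric coordinates on the finite set `s`, extended by zero. -/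
structure IsWeight {X : Type*} (s : Finset X) (w : X → ℝ) : Prop where
  nonneg : ∀ v, 0 ≤ w v
  eq_zero : ∀ v ∉ s, w v = 0
  sum_eq_one : ∑ v ∈ s, w v = 1

theorem mem_convexHull_iff_exists_isWeight {s : Finset E} {x : E} :
    x ∈ convexHull ℝ (s : Set E) ↔ ∃ w, IsWeight s w ∧ ∑ v ∈ s, w v • v = x := by
  classical
  constructor
  · intro hx
    obtain ⟨w, h0, h1, h2⟩ := Finset.mem_convexHull'.1 hx
    refine ⟨fun v => if v ∈ s then w v else 0, ⟨fun v => ?_, fun v hv => if_neg hv, ?_⟩, ?_⟩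
    · split_ifs with hv
      exacts [h0 v hv, le_rfl]
    · rw [← h1]
      exact Finset.sum_congr rfl fun v hv => if_pos hv
    · rw [← h2]
      exact Finset.sum_congr rfl fun v hv => by simp only [if_pos hv]
  · rintro ⟨w, hw, hx⟩
    exact Finset.mem_convexHull'.2 ⟨w, fun v _ => hw.nonneg v, hw.sum_eq_one, hx⟩

/-- Every point has at most one system of barycentric coordinates with support in a set of the
family `F`. For a family of nonempty finite sets that is closed under passing to nonempty subsets
this is equivalent to being a simplicial complex. -/
def UniqueWeights (F : Set (Finset E)) : Prop :=
  ∀ s ∈ F, ∀ s' ∈ F, ∀ w w' : E → ℝ, IsWeight s w → IsWeight s' w' →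
    ∑ v ∈ s, w v • v = ∑ v ∈ s', w' v • v → w = w'

theorem IsWeight.mono {X : Type*} {s s' : Finset X} {w : X → ℝ} (hw : IsWeight s w) (h : s ⊆ s') :
    IsWeight s' w :=
  ⟨hw.nonneg, fun v hv => hw.eq_zero v fun hv' => hv (h hv'), by
    rw [← hw.sum_eq_one, Finset.sum_subset h fun v _ hv => hw.eq_zero v hv]⟩

theorem IsWeight.sum_smul_of_subset {s s' : Finset E} {w : E → ℝ} (hw : IsWeight s w)
    (h : s ⊆ s') : ∑ v ∈ s', w v • v = ∑ v ∈ s, w v • v :=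
  (Finset.sum_subset h fun v _ hv => by rw [hw.eq_zero v hv, zero_smul]).symm

theorem IsWeight.eq_of_affineIndependent {s : Finset E} {w w' : E → ℝ}
    (hs : AffineIndependent ℝ ((↑) : s → E)) (hw : IsWeight s w) (hw' : IsWeight s w')
    (h : ∑ v ∈ s, w v • v = ∑ v ∈ s, w' v • v) : w = w' := by
  have h1 := (affineIndependent_iff (k := ℝ)).1 hs Finset.univ (fun v => w v - w' v)
    (by rw [Finset.sum_coe_sort s fun v => w v - w' v, Finset.sum_sub_distrib, hw.sum_eq_one,
      hw'.sum_eq_one, sub_self])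
    (by rw [Finset.sum_coe_sort s fun v => (w v - w' v) • v]
        simp only [sub_smul, Finset.sum_sub_distrib, h, sub_self])
  ext v
  by_cases hv : v ∈ s
  · exact sub_eq_zero.1 (h1 ⟨v, hv⟩ (Finset.mem_univ _))
  · rw [hw.eq_zero v hv, hw'.eq_zero v hv]

theorem uniqueWeights_faces (K : Geometry.SimplicialComplex ℝ E) : UniqueWeights K.faces := by
  classical
  intro s hs s' hs' w w' hw hw' h
  have hx : ∑ v ∈ s, w v • v ∈ convexHull ℝ ((s ∩ s' : Finset E) : Set E) := by
    rw [Finset.coe_inter]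
    exact K.inter_subset_convexHull hs hs'
      ⟨mem_convexHull_iff_exists_isWeight.2 ⟨w, hw, rfl⟩,
        mem_convexHull_iff_exists_isWeight.2 ⟨w', hw', h.symm⟩⟩
  obtain ⟨u, hu, hux⟩ := mem_convexHull_iff_exists_isWeight.1 hx
  rw [hw.eq_of_affineIndependent (K.indep hs) (hu.mono Finset.inter_subset_left)
      (by rw [hu.sum_smul_of_subset Finset.inter_subset_left, hux]),
    hw'.eq_of_affineIndependent (K.indep hs') (hu.mono Finset.inter_subset_right)
      (by rw [hu.sum_smul_of_subset Finset.inter_subset_right, hux, h])]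

/-- The simplicial complex on a family of sets with unique barycentric coordinates. -/
def complexOfUniqueWeights (F : Set (Finset E)) (hne : ∀ s ∈ F, s.Nonempty)
    (hdown : ∀ s ∈ F, ∀ t ⊆ s, t.Nonempty → t ∈ F) (hF : UniqueWeights F) :
    Geometry.SimplicialComplex ℝ E where
  faces := F
  isRelLowerSet_faces := fun s hs => ⟨hne s hs, fun t hts ht => hdown s hs t hts ht⟩
  indep := by
    classical
    intro s hs
    by_contra h
    -- a Radon partition gives a point with two systems of coordinates with disjoint supports
    obtain ⟨I, x, hx1, hx2⟩ := Convex.radon_partition h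
    have key (J : Set s) : ∃ t : Finset E, t ⊆ s ∧ (t : Set E) = (↑) '' J := by
      refine ⟨(J.toFinite.image (↑)).toFinset, fun v hv => ?_, by simp⟩
      simp only [Set.Finite.mem_toFinset, Set.mem_image] at hv
      obtain ⟨y, _, rfl⟩ := hv
      exact y.2
    obtain ⟨t1, ht1, h1⟩ := key I
    obtain ⟨t2, ht2, h2⟩ := key Iᶜ
    rw [← h1] at hx1
    rw [← h2] at hx2
    obtain ⟨w1, hw1, hwx1⟩ := mem_convexHull_iff_exists_isWeight.1 hx1
    obtain ⟨w2, hw2, hwx2⟩ := mem_convexHull_iff_exists_isWeight.1 hx2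
    have hw := hF s hs s hs w1 w2 (hw1.mono ht1) (hw2.mono ht2)
      (by rw [hw1.sum_smul_of_subset ht1, hw2.sum_smul_of_subset ht2, hwx1, hwx2])
    have hzero : ∑ v ∈ t1, w1 v = 0 := by
      refine Finset.sum_eq_zero fun v hv => ?_
      rw [hw]
      refine hw2.eq_zero v fun hv2 => ?_
      have hv1 : v ∈ (t1 : Set E) := hv
      have hv2' : v ∈ (t2 : Set E) := hv2
      rw [h1] at hv1
      rw [h2] at hv2'
      obtain ⟨a, ha, rfl⟩ := hv1
      obtain ⟨b, hb, hab⟩ := hv2'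
      exact hb (Subtype.ext hab ▸ ha)
    rw [hw1.sum_eq_one] at hzero
    exact one_ne_zero hzero
  inter_subset_convexHull := by
    classical
    rintro s t hs ht x ⟨hxs, hxt⟩
    obtain ⟨w, hw, hwx⟩ := mem_convexHull_iff_exists_isWeight.1 hxs
    obtain ⟨w', hw', hwx'⟩ := mem_convexHull_iff_exists_isWeight.1 hxt
    obtain rfl := hF s hs t ht w w' hw hw' (hwx.trans hwx'.symm)
    have hzero : ∀ v ∈ s, v ∉ s ∩ t → w v = 0 := fun v hv hvt =>
      hw'.eq_zero v fun h => hvt (Finset.mem_inter.2 ⟨hv, h⟩)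
    rw [← Finset.coe_inter, mem_convexHull_iff_exists_isWeight]
    refine ⟨w, ⟨hw.nonneg, fun v hv => ?_, ?_⟩, ?_⟩
    · by_cases hvs : v ∈ s
      exacts [hzero v hvs hv, hw.eq_zero v hvs]
    · rw [Finset.sum_subset Finset.inter_subset_left hzero, hw.sum_eq_one]
    · rw [Finset.sum_subset Finset.inter_subset_left
        fun v hv hvt => by rw [hzero v hv hvt, zero_smul], hwx]

/-- Every simplex has a point that lies in no other simplex of the complex than those that have
it as a face. -/
theorem exists_mem_convexHull_forall_subset (K : Geometry.SimplicialComplex ℝ E) {s : Finset E}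
    (hs : s ∈ K.faces) :
    ∃ x ∈ convexHull ℝ (s : Set E), ∀ t ∈ K.faces, x ∈ convexHull ℝ (t : Set E) → s ⊆ t := by
  classical
  have hcard : (0 : ℝ) < s.card := by
    exact_mod_cast Finset.card_pos.2 (K.nonempty_of_mem_faces hs)
  let w (v : E) : ℝ := if v ∈ s then (s.card : ℝ)⁻¹ else 0
  have hw : IsWeight s w := by
    refine ⟨fun v => ?_, fun v hv => if_neg hv, ?_⟩
    · simp only [w]
      split_ifs <;> positivity
    · rw [Finset.sum_congr rfl fun v hv => if_pos hv, Finset.sum_const, nsmul_eq_mul,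
        mul_inv_cancel₀ hcard.ne']
  refine ⟨_, mem_convexHull_iff_exists_isWeight.2 ⟨w, hw, rfl⟩, fun t ht hx v hv => ?_⟩
  obtain ⟨w', hw', hwx'⟩ := mem_convexHull_iff_exists_isWeight.1 hx
  have h := uniqueWeights_faces K s hs t ht w w' hw hw' hwx'.symm
  by_contra hvt
  have h0 : w v = 0 := by rw [h, hw'.eq_zero v hvt]
  simp only [w, if_pos hv] at h0
  exact hcard.ne' (inv_eq_zero.1 h0)

/-! ### Listing the vertices in order -/

/-- A strict linear order on a finite set is given by a rank function. -/
theorem LinearOn.exists_rank {X : Type*} {lt : X → X → Prop} {V : Set X} (h : LinearOn lt V)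
    (hV : V.Finite) :
    ∃ ρ : X → ℕ, Set.InjOn ρ V ∧ ∀ a ∈ V, ∀ b ∈ V, lt a b ↔ ρ a < ρ b := by
  classical
  obtain ⟨hirr, htrans, htot⟩ := h
  let ρ (a : X) : ℕ := {b ∈ hV.toFinset | lt b a}.card
  have hlt : ∀ a ∈ V, ∀ b ∈ V, lt a b → ρ a < ρ b := fun a ha b hb hab => by
    refine Finset.card_lt_card ((Finset.ssubset_iff_of_subset fun c hc => ?_).2 ⟨a, ?_, ?_⟩)
    · simp only [Finset.mem_filter, Set.Finite.mem_toFinset] at hc ⊢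
      exact ⟨hc.1, htrans c hc.1 a ha b hb hc.2 hab⟩
    · simp [ha, hab]
    · simp [hirr a ha]
  have hinj : Set.InjOn ρ V := fun a ha b hb hab => by
    by_contra hne
    rcases htot a ha b hb hne with h | h
    · exact (hlt a ha b hb h).ne hab
    · exact (hlt b hb a ha h).ne hab.symm
  refine ⟨ρ, hinj, fun a ha b hb => ⟨hlt a ha b hb, fun h => ?_⟩⟩
  by_contra hab
  rcases eq_or_ne a b with rfl | hne
  · exact lt_irrefl _ h
  · exact lt_asymm h (hlt b hb a ha ((htot a ha b hb hne).resolve_left hab))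

theorem LinearOn.mono {X : Type*} {lt : X → X → Prop} {V W : Set X} (h : LinearOn lt V)
    (hWV : W ⊆ V) :
    LinearOn lt W :=
  ⟨fun a ha => h.1 a (hWV ha),
    fun a ha b hb c hc => h.2.1 a (hWV ha) b (hWV hb) c (hWV hc),
    fun a ha b hb => h.2.2 a (hWV ha) b (hWV hb)⟩

theorem LinearOn.exists_lists {X : Type*} {lt : X → X → Prop} {s : Finset X}
    (h : LinearOn lt (s : Set X))
    {r : ℕ} (hr : s.card = r + 1) : ∃ T : Fin (r + 1) → X, Lists lt s T := by
  obtain ⟨ρ, hinj, hρ⟩ := h.exists_rank s.finite_toSet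
  let e : Fin (r + 1) ≃ s := (s.equivFinOfCardEq hr).symm
  have he : Function.Injective fun k => ρ (e k) := fun a b hab =>
    e.injective (Subtype.ext (hinj (e a).2 (e b).2 hab))
  let τ := Tuple.sort fun k => ρ (e k)
  refine ⟨fun k => e (τ k), fun i j hij => ?_, ?_⟩
  · rw [hρ _ (e _).2 _ (e _).2]
    exact lt_of_le_of_ne (Tuple.monotone_sort (fun k => ρ (e k)) hij.le) fun h =>
      hij.ne (τ.injective (he h))
  · ext v
    refine ⟨?_, fun hv => ⟨τ.symm (e.symm ⟨v, hv⟩), by simp⟩⟩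
    rintro ⟨k, rfl⟩
    exact (e (τ k)).2

theorem Lists.card_eq {X : Type*} {lt : X → X → Prop} {s : Finset X} {r : ℕ} {T : Fin (r + 1) → X}
    (hT : Lists lt s T) (h : LinearOn lt (s : Set X)) : s.card = r + 1 := by
  classical
  have hmem (k) : T k ∈ (s : Set X) := hT.2 ▸ Set.mem_range_self k
  have hinj : Function.Injective T := fun a b hab => by
    have hne (a b) (hlt : a < b) : T a ≠ T b := fun heq =>
      h.1 _ (hmem b) (by simpa [heq] using hT.1 a b hlt)
    exact le_antisymm (not_lt.1 fun h => hne b a h hab.symm) (not_lt.1 fun h => hne a b h hab)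
  have : s = Finset.univ.image T := by
    apply Finset.coe_injective
    simp [hT.2]
  rw [this, Finset.card_image_of_injective _ hinj, Finset.card_fin]

/-! ### Chains of pairs of vertices -/

/-- The marginal on the vertices of a weight on pairs of vertices: each pair gives half of its
weight to each of its two entries. -/
noncomputable def marginal {X : Type*} [DecidableEq X] (P : Finset (X × X)) (a : X × X → ℝ)
    (v : X) : ℝ :=
  ∑ p ∈ P, a p * ((if p.1 = v then 1 / 2 else 0) + if p.2 = v then 1 / 2 else 0)

theorem sum_marginal_smul {X M : Type*} [DecidableEq X] [AddCommGroup M] [Module ℝ M]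
    {P : Finset (X × X)} {a : X × X → ℝ} {V : Finset X}
    (hV : ∀ p ∈ P, a p ≠ 0 → p.1 ∈ V ∧ p.2 ∈ V) (f : X → M) :
    ∑ v ∈ V, marginal P a v • f v = ∑ p ∈ P, a p • (1 / 2 : ℝ) • (f p.1 + f p.2) := by
  simp only [marginal, Finset.sum_smul]
  rw [Finset.sum_comm]
  refine Finset.sum_congr rfl fun p hp => ?_
  by_cases hap : a p = 0
  · simp [hap]
  obtain ⟨h1, h2⟩ := hV p hp hap
  simp only [mul_smul, ← Finset.smul_sum, add_smul, ite_smul, zero_smul, Finset.sum_add_distrib,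
    Finset.sum_ite_eq, h1, h2, if_true, smul_add]

theorem isWeight_marginal {X : Type*} [DecidableEq X] {P : Finset (X × X)} {a : X × X → ℝ}
    {V : Finset X} (hV : ∀ p ∈ P, a p ≠ 0 → p.1 ∈ V ∧ p.2 ∈ V) (h0 : ∀ p ∈ P, 0 ≤ a p)
    (h1 : ∑ p ∈ P, a p = 1) : IsWeight V (marginal P a) where
  nonneg v := Finset.sum_nonneg fun p hp => mul_nonneg (h0 p hp) (by split_ifs <;> norm_num)
  eq_zero v hv := Finset.sum_eq_zero fun p hp => by
    by_cases hap : a p = 0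
    · simp [hap]
    obtain ⟨h1, h2⟩ := hV p hp hap
    rw [if_neg fun h : p.1 = v => hv (h ▸ h1), if_neg fun h : p.2 = v => hv (h ▸ h2), add_zero,
      mul_zero]
  sum_eq_one := by
    have h := sum_marginal_smul hV fun _ => (1 : ℝ)
    norm_num at h
    rw [h, h1]

/-- `Q` is a set of pairs of elements of `S` that is a chain for the product order and in which
every first entry is at most every second entry, the elements being ordered by `ρ`. -/
structure IsPairChain {X : Type*} (ρ : X → ℕ) (S : Finset X) (Q : Finset (X × X)) : Prop where
  mem : ∀ p ∈ Q, p.1 ∈ S ∧ p.2 ∈ S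
  chain : ∀ p ∈ Q, ∀ q ∈ Q, (ρ p.1 ≤ ρ q.1 ∧ ρ p.2 ≤ ρ q.2) ∨ (ρ q.1 ≤ ρ p.1 ∧ ρ q.2 ≤ ρ p.2)
  fst_le_snd : ∀ p ∈ Q, ∀ q ∈ Q, ρ p.1 ≤ ρ q.2

theorem IsPairChain.isChainWeight {X : Type*} {ρ : X → ℕ} {S : Finset X} {P Q : Finset (X × X)}
    {a : X × X → ℝ} (hQ : IsPairChain ρ S Q) (h0 : ∀ p ∈ P, 0 ≤ a p)
    (haQ : ∀ p ∈ P, a p ≠ 0 → p ∈ Q) (h1 : ∑ p ∈ P, a p = 1) :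
    IsChainWeight P (fun p => ρ p.1) (fun p => ρ p.2) a :=
  ⟨h0, h1, fun p hp q hq hap haq => hQ.chain p (haQ p hp hap) q (haQ q hq haq),
    fun p hp q hq hap haq => hQ.fst_le_snd p (haQ p hp hap) q (haQ q hq haq)⟩

theorem mem_vertices_of_mem {K : Geometry.SimplicialComplex ℝ E} {S : Finset E} (hS : S ∈ K.faces)
    {v : E} (hv : v ∈ S) : v ∈ K.vertices :=
  K.down_closed hS (Finset.singleton_subset_iff.2 hv) (Finset.singleton_nonempty v)

/-- A convex combination of midpoints along a chain of pairs determines its weights: it determines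
its barycentric coordinates in the old complex, that is, the marginal of the weights. -/
theorem IsPairChain.eq_of_sum_smul_midpoint_eq {K : Geometry.SimplicialComplex ℝ E} {ρ : E → ℕ}
    (hρ : Set.InjOn ρ K.vertices) {S S' : Finset E} (hS : S ∈ K.faces) (hS' : S' ∈ K.faces)
    {P Q Q' : Finset (E × E)} (hQ : IsPairChain ρ S Q) (hQ' : IsPairChain ρ S' Q')
    (hP : ∀ p ∈ P, p ∈ Q ∨ p ∈ Q') {a a' : E × E → ℝ}
    (h0 : ∀ p ∈ P, 0 ≤ a p) (h0' : ∀ p ∈ P, 0 ≤ a' p)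
    (haQ : ∀ p ∈ P, a p ≠ 0 → p ∈ Q) (haQ' : ∀ p ∈ P, a' p ≠ 0 → p ∈ Q')
    (h1 : ∑ p ∈ P, a p = 1) (h1' : ∑ p ∈ P, a' p = 1)
    (h : ∑ p ∈ P, a p • midpoint ℝ p.1 p.2 = ∑ p ∈ P, a' p • midpoint ℝ p.1 p.2) :
    ∀ p ∈ P, a p = a' p := by
  classical
  have hV : ∀ p ∈ P, a p ≠ 0 → p.1 ∈ S ∧ p.2 ∈ S := fun p hp hap => hQ.mem p (haQ p hp hap)
  have hV' : ∀ p ∈ P, a' p ≠ 0 → p.1 ∈ S' ∧ p.2 ∈ S' := fun p hp hap => hQ'.mem p (haQ' p hp hap)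
  have hm (p : E × E) : midpoint ℝ p.1 p.2 = (1 / 2 : ℝ) • (id p.1 + id p.2) := by
    rw [midpoint_eq_smul_add, invOf_eq_inv, one_div, id, id]
  have hw : marginal P a = marginal P a' := by
    refine uniqueWeights_faces K S hS S' hS' _ _ (isWeight_marginal hV h0 h1)
      (isWeight_marginal hV' h0' h1') ?_
    simp only [hm] at h
    exact (sum_marginal_smul hV id).trans (h.trans (sum_marginal_smul hV' id).symm)
  have hPv : ∀ p ∈ P, p.1 ∈ K.vertices ∧ p.2 ∈ K.vertices := fun p hp => by
    rcases hP p hp with h | h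
    · exact ⟨mem_vertices_of_mem hS (hQ.mem p h).1, mem_vertices_of_mem hS (hQ.mem p h).2⟩
    · exact ⟨mem_vertices_of_mem hS' (hQ'.mem p h).1, mem_vertices_of_mem hS' (hQ'.mem p h).2⟩
  refine IsChainWeight.ext (fun p hp q hq hpq1 hpq2 => ?_) (hQ.isChainWeight h0 haQ h1)
    (hQ'.isChainWeight h0' haQ' h1') fun c => ?_
  · exact Prod.ext (hρ (hPv p hp).1 (hPv q hq).1 hpq1) (hρ (hPv p hp).2 (hPv q hq).2 hpq2)
  · have key (b : E × E → ℝ) (hb : ∀ p ∈ P, b p ≠ 0 → p.1 ∈ S ∪ S' ∧ p.2 ∈ S ∪ S') :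
        ∑ p ∈ P with ρ p.1 ≤ c, b p + ∑ p ∈ P with ρ p.2 ≤ c, b p =
          2 * ∑ v ∈ S ∪ S', marginal P b v • if ρ v ≤ c then (1 : ℝ) else 0 := by
      rw [sum_marginal_smul hb, Finset.sum_filter, Finset.sum_filter, ← Finset.sum_add_distrib,
        Finset.mul_sum]
      refine Finset.sum_congr rfl fun p _ => ?_
      split_ifs <;> simp <;> ring
    rw [key a fun p hp hap => ⟨Finset.mem_union_left _ (hV p hp hap).1,
        Finset.mem_union_left _ (hV p hp hap).2⟩,
      key a' fun p hp hap => ⟨Finset.mem_union_right _ (hV' p hp hap).1,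
        Finset.mem_union_right _ (hV' p hp hap).2⟩, hw]

theorem isPairChain_singleton {X : Type*} {ρ : X → ℕ} {S : Finset X} {p : X × X} (h1 : p.1 ∈ S)
    (h2 : p.2 ∈ S) (h : ρ p.1 ≤ ρ p.2) : IsPairChain ρ S {p} := by
  refine ⟨fun q hq => ?_, fun q hq q' hq' => ?_, fun q hq q' hq' => ?_⟩ <;>
    simp only [Finset.mem_singleton] at hq <;> subst hq
  · exact ⟨h1, h2⟩
  · simp only [Finset.mem_singleton] at hq'
    subst hq'
    exact Or.inl ⟨le_rfl, le_rfl⟩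
  · simp only [Finset.mem_singleton] at hq'
    subst hq'
    exact h

/-- A new vertex is the midpoint of a single ordered pair of old vertices that span a simplex. -/
theorem eq_of_midpoint_eq {K : Geometry.SimplicialComplex ℝ E} {ρ : E → ℕ}
    (hρ : Set.InjOn ρ K.vertices) {S S' : Finset E} (hS : S ∈ K.faces) (hS' : S' ∈ K.faces)
    {p p' : E × E} (hp : IsPairChain ρ S {p}) (hp' : IsPairChain ρ S' {p'})
    (h : midpoint ℝ p.1 p.2 = midpoint ℝ p'.1 p'.2) : p = p' := by
  classical
  have key := IsPairChain.eq_of_sum_smul_midpoint_eq hρ hS hS' hp hp' (P := {p, p'})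
    (a := fun q => if q = p then 1 else 0) (a' := fun q => if q = p' then 1 else 0)
    (by simp) (fun q _ => by split_ifs <;> norm_num)
    (fun q _ => by split_ifs <;> norm_num) (by simp) (by simp) (by simp) (by simp)
    (by simpa using h) p (by simp)
  by_contra hne
  simp [hne] at key

/-! ### One step of the process -/

section Step

variable {K : Geometry.SimplicialComplex ℝ E} {lt : E → E → Prop}

theorem finite_vertices (hfin : K.faces.Finite) : K.vertices.Finite := by
  rw [Geometry.SimplicialComplex.vertices_eq]
  exact hfin.biUnion fun s _ => s.finite_toSet

theorem coe_subset_vertices {S : Finset E} (hS : S ∈ K.faces) : (S : Set E) ⊆ K.vertices :=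
  fun _ hv => mem_vertices_of_mem hS hv

theorem Lists.mem {X : Type*} {lt : X → X → Prop} {s : Finset X} {r : ℕ} {T : Fin (r + 1) → X}
    (hT : Lists lt s T) (k : Fin (r + 1)) : T k ∈ s := by
  have : T k ∈ (s : Set X) := hT.2 ▸ Set.mem_range_self k
  exact this

theorem Lists.strictMono {ρ : E → ℕ} (hlt : ∀ a ∈ K.vertices, ∀ b ∈ K.vertices, lt a b ↔ ρ a < ρ b)
    {S : Finset E} (hS : S ∈ K.faces) {r : ℕ} {T : Fin (r + 1) → E} (hT : Lists lt S T) :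
    StrictMono fun k => ρ (T k) := fun i j hij =>
  (hlt _ (mem_vertices_of_mem hS (hT.mem i)) _ (mem_vertices_of_mem hS (hT.mem j))).1 (hT.1 i j hij)

theorem exists_isPairChain_of_mem_Z_faces {ρ : E → ℕ}
    (hlt : ∀ a ∈ K.vertices, ∀ b ∈ K.vertices, lt a b ↔ ρ a < ρ b) {s : Finset E}
    (hs : s ∈ (Z ⟨K.faces, lt⟩).faces) :
    ∃ S ∈ K.faces, ∃ Q, IsPairChain ρ S Q ∧
      (s : Set E) = (fun p : E × E => midpoint ℝ p.1 p.2) '' Q := by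
  classical
  obtain ⟨-, S, hS, r, T, hT, t, ht, hst⟩ := hs
  obtain ⟨i, j, hi, hj, hij, -, hval⟩ := exists_path_of_mem_cells ht
  have hmono := (hT.strictMono hlt hS).monotone
  refine ⟨S, hS, (Finset.univ.filter fun m => t m ∈ s).image fun m => (T (i m), T (j m)),
    ⟨?_, ?_, ?_⟩, ?_⟩
  · simp only [Finset.mem_image]
    rintro _ ⟨m, -, rfl⟩
    exact ⟨hT.mem _, hT.mem _⟩
  · simp only [Finset.mem_image]
    rintro _ ⟨m, -, rfl⟩ _ ⟨n, -, rfl⟩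
    rcases le_total m n with h | h
    · exact Or.inl ⟨hmono (hi h), hmono (hj h)⟩
    · exact Or.inr ⟨hmono (hi h), hmono (hj h)⟩
  · simp only [Finset.mem_image]
    rintro _ ⟨m, -, rfl⟩ _ ⟨n, -, rfl⟩
    exact hmono (hij m n)
  · ext v
    simp only [Finset.coe_image, Finset.coe_filter, Finset.mem_univ, true_and, Set.image_image,
      ← hval, Set.mem_image, Finset.mem_coe, Set.mem_ofPred_eq]
    constructor
    · intro hv
      obtain ⟨m, rfl⟩ := hst hv
      exact ⟨m, hv, rfl⟩
    · rintro ⟨m, hm, rfl⟩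
      exact hm

/-- Weights on the image of `Q` under an injective map, pulled back and extended by zero to `R`. -/
theorem sum_ite_mem_comp {X Y M : Type*} [DecidableEq X] [DecidableEq Y] [AddCommMonoid M]
    {μ : X → Y} {Q R : Finset X} (hQR : Q ⊆ R) (hinj : Set.InjOn μ Q) (w : Y → ℝ) (f : ℝ → Y → M)
    (hf : ∀ v, f 0 v = 0) :
    ∑ p ∈ R, f (if p ∈ Q then w (μ p) else 0) (μ p) = ∑ v ∈ Q.image μ, f (w v) v := by
  rw [Finset.sum_image hinj, ← Finset.sum_subset hQR fun p _ hp => by rw [if_neg hp, hf]]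
  exact Finset.sum_congr rfl fun p hp => by rw [if_pos hp]

theorem uniqueWeights_Z_faces {ρ : E → ℕ} (hρ : Set.InjOn ρ K.vertices)
    (hlt : ∀ a ∈ K.vertices, ∀ b ∈ K.vertices, lt a b ↔ ρ a < ρ b) :
    UniqueWeights (Z ⟨K.faces, lt⟩).faces := by
  classical
  intro s hs s' hs' w w' hw hw' h
  obtain ⟨S, hS, Q, hQ, hsQ⟩ := exists_isPairChain_of_mem_Z_faces hlt hs
  obtain ⟨S', hS', Q', hQ', hsQ'⟩ := exists_isPairChain_of_mem_Z_faces hlt hs'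
  let μ (p : E × E) : E := midpoint ℝ p.1 p.2
  have hsQ : s = Q.image μ := Finset.coe_injective (by rw [hsQ, Finset.coe_image])
  have hsQ' : s' = Q'.image μ := Finset.coe_injective (by rw [hsQ', Finset.coe_image])
  have hone {S Q} (hQ : IsPairChain ρ S Q) {p : E × E} (hp : p ∈ Q) : IsPairChain ρ S {p} :=
    isPairChain_singleton (hQ.mem p hp).1 (hQ.mem p hp).2 (hQ.fst_le_snd p hp p hp)
  have hinj : Set.InjOn μ Q := fun p hp q hq hpq =>
    eq_of_midpoint_eq hρ hS hS (hone hQ hp) (hone hQ hq) hpq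
  have hinj' : Set.InjOn μ Q' := fun p hp q hq hpq =>
    eq_of_midpoint_eq hρ hS' hS' (hone hQ' hp) (hone hQ' hq) hpq
  have key := IsPairChain.eq_of_sum_smul_midpoint_eq hρ hS hS' hQ hQ' (P := Q ∪ Q')
    (a := fun p => if p ∈ Q then w (μ p) else 0) (a' := fun p => if p ∈ Q' then w' (μ p) else 0)
    (fun p hp => Finset.mem_union.1 hp)
    (fun p _ => by split_ifs <;> [exact hw.nonneg _; exact le_rfl])
    (fun p _ => by split_ifs <;> [exact hw'.nonneg _; exact le_rfl])
    (fun p _ hp => by by_contra hpQ; exact hp (if_neg hpQ))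
    (fun p _ hp => by by_contra hpQ; exact hp (if_neg hpQ))
    ((sum_ite_mem_comp (R := Q ∪ Q') Finset.subset_union_left hinj w
      (fun c _ => c) fun _ => rfl).trans
      (by rw [← hsQ, hw.sum_eq_one]))
    ((sum_ite_mem_comp (R := Q ∪ Q') Finset.subset_union_right hinj' w'
      (fun c _ => c) fun _ => rfl).trans
      (by rw [← hsQ', hw'.sum_eq_one]))
    ((sum_ite_mem_comp (R := Q ∪ Q') Finset.subset_union_left hinj w
      (fun c v => c • v) fun _ => zero_smul _ _).trans
      (by rw [← hsQ, h, hsQ']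
          exact (sum_ite_mem_comp (R := Q ∪ Q') Finset.subset_union_right hinj' w'
            (fun c v => c • v) fun _ => zero_smul _ _).symm))
  have hmem {p : E × E} (hp : p ∈ Q) (hp' : p ∉ Q') : μ p ∉ s' := fun h => by
    rw [hsQ', Finset.mem_image] at h
    obtain ⟨q, hq, hqp⟩ := h
    exact hp' (eq_of_midpoint_eq hρ hS' hS (hone hQ' hq) (hone hQ hp) hqp ▸ hq)
  have hmem' {p : E × E} (hp : p ∈ Q') (hp' : p ∉ Q) : μ p ∉ s := fun h => by
    rw [hsQ, Finset.mem_image] at h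
    obtain ⟨q, hq, hqp⟩ := h
    exact hp' (eq_of_midpoint_eq hρ hS hS' (hone hQ hq) (hone hQ' hp) hqp ▸ hq)
  ext v
  by_cases hv : v ∈ s
  · rw [hsQ, Finset.mem_image] at hv
    obtain ⟨p, hp, rfl⟩ := hv
    have := key p (Finset.mem_union_left _ hp)
    simp only [if_pos hp] at this
    rw [this]
    split_ifs with hp'
    exacts [rfl, (hw'.eq_zero _ (hmem hp hp')).symm]
  by_cases hv' : v ∈ s'
  · rw [hsQ', Finset.mem_image] at hv'
    obtain ⟨p, hp, rfl⟩ := hv'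
    have := key p (Finset.mem_union_right _ hp)
    simp only [if_pos hp] at this
    rw [← this]
    split_ifs with hp'
    exacts [rfl, hw.eq_zero _ (hmem' hp hp')]
  · rw [hw.eq_zero v hv, hw'.eq_zero v hv']

theorem finite_Z_faces (hfin : K.faces.Finite) : (Z ⟨K.faces, lt⟩).faces.Finite := by
  classical
  have hV := finite_vertices hfin
  have hM := (hV.prod hV).image fun p : E × E => midpoint ℝ p.1 p.2
  refine (hM.toFinset.powerset.finite_toSet).subset ?_
  rintro s ⟨-, S, hS, r, T, hT, t, ht, hst⟩
  obtain ⟨i, j, -, -, -, -, hval⟩ := exists_path_of_mem_cells ht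
  simp only [Finset.coe_powerset, Set.mem_preimage, Set.mem_powerset_iff, Set.Finite.coe_toFinset]
  intro v hv
  obtain ⟨m, rfl⟩ := hst hv
  exact ⟨(T (i m), T (j m)), ⟨mem_vertices_of_mem hS (hT.mem _),
    mem_vertices_of_mem hS (hT.mem _)⟩, (hval m).symm⟩

theorem isPairChain_of_isEdge {ρ : E → ℕ}
    (hlt : ∀ a ∈ K.vertices, ∀ b ∈ K.vertices, lt a b ↔ ρ a < ρ b) {p q : E}
    (h : OrderedFaces.IsEdge ⟨K.faces, lt⟩ p q) : ∃ S ∈ K.faces, IsPairChain ρ S {(p, q)} := by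
  obtain ⟨⟨S, hS, hpq⟩, h⟩ := h
  have hp : p ∈ S := by rw [← Finset.mem_coe, hpq]; simp
  have hq : q ∈ S := by rw [← Finset.mem_coe, hpq]; simp
  refine ⟨S, hS, isPairChain_singleton hp hq ?_⟩
  rcases h with rfl | h
  · exact le_rfl
  · exact ((hlt p (mem_vertices_of_mem hS hp) q (mem_vertices_of_mem hS hq)).1 h).le

theorem isEdge_of_mem {ρ : E → ℕ} (hρ : Set.InjOn ρ K.vertices)
    (hlt : ∀ a ∈ K.vertices, ∀ b ∈ K.vertices, lt a b ↔ ρ a < ρ b) {S : Finset E}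
    (hS : S ∈ K.faces) {p q : E} (hp : p ∈ S) (hq : q ∈ S) (hpq : ρ p ≤ ρ q) :
    OrderedFaces.IsEdge ⟨K.faces, lt⟩ p q := by
  classical
  refine ⟨⟨{p, q}, K.down_closed hS ?_ (by simp), by simp⟩, ?_⟩
  · intro v hv
    rcases Finset.mem_insert.1 hv with rfl | hv
    · exact hp
    · rwa [Finset.mem_singleton.1 hv]
  · have hp' := mem_vertices_of_mem hS hp
    have hq' := mem_vertices_of_mem hS hq
    rcases hpq.eq_or_lt with h | h
    · exact Or.inl (hρ hp' hq' h)
    · exact Or.inr ((hlt p hp' q hq').2 h)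

/-- The order of the new vertices compares the pairs they come from lexicographically; this is well
defined as the pairs are unique. -/
theorem Z_lt_midpoint_iff {ρ : E → ℕ} (hρ : Set.InjOn ρ K.vertices)
    (hlt : ∀ a ∈ K.vertices, ∀ b ∈ K.vertices, lt a b ↔ ρ a < ρ b) {p q p' q' : E}
    (h : OrderedFaces.IsEdge ⟨K.faces, lt⟩ p q) (h' : OrderedFaces.IsEdge ⟨K.faces, lt⟩ p' q') :
    (Z ⟨K.faces, lt⟩).lt (midpoint ℝ p q) (midpoint ℝ p' q') ↔
      toLex (ρ p, ρ q) < toLex (ρ p', ρ q') := by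
  obtain ⟨S, hS, hc⟩ := isPairChain_of_isEdge hlt h
  obtain ⟨S', hS', hc'⟩ := isPairChain_of_isEdge hlt h'
  have hv := hc.mem (p, q) (by simp)
  have hv' := hc'.mem (p', q') (by simp)
  have hp := mem_vertices_of_mem hS hv.1
  have hq := mem_vertices_of_mem hS hv.2
  have hp' := mem_vertices_of_mem hS' hv'.1
  have hq' := mem_vertices_of_mem hS' hv'.2
  rw [Prod.Lex.toLex_lt_toLex]
  constructor
  · rintro ⟨p₁, q₁, p₁', q₁', h₁, h₁', hm, hm', hor⟩
    obtain ⟨S₁, hS₁, hc₁⟩ := isPairChain_of_isEdge hlt h₁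
    obtain ⟨S₁', hS₁', hc₁'⟩ := isPairChain_of_isEdge hlt h₁'
    obtain ⟨rfl, rfl⟩ := Prod.mk.inj (eq_of_midpoint_eq hρ hS hS₁ hc hc₁ hm)
    obtain ⟨rfl, rfl⟩ := Prod.mk.inj (eq_of_midpoint_eq hρ hS' hS₁' hc' hc₁' hm')
    rcases hor with hor | ⟨rfl, hor⟩
    · exact Or.inl ((hlt _ hp _ hp').1 hor)
    · exact Or.inr ⟨rfl, (hlt _ hq _ hq').1 hor⟩
  · intro hor
    refine ⟨p, q, p', q', h, h', rfl, rfl, ?_⟩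
    rcases hor with hor | ⟨h1, h2⟩
    · exact Or.inl ((hlt _ hp _ hp').2 hor)
    · exact Or.inr ⟨hρ hp hp' h1, (hlt _ hq _ hq').2 h2⟩

/-- The result of the process is again a finite simplicial complex with ordered vertices. -/
theorem exists_complex_Z (hfin : K.faces.Finite) (hlin : LinearOn lt K.vertices) :
    ∃ K' : Geometry.SimplicialComplex ℝ E, K'.faces = (Z ⟨K.faces, lt⟩).faces ∧
      LinearOn (Z ⟨K.faces, lt⟩).lt K'.vertices := by
  have hV := finite_vertices hfin
  obtain ⟨ρ, hρ, hlt⟩ := hlin.exists_rank hV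
  let K' := complexOfUniqueWeights (Z ⟨K.faces, lt⟩).faces (fun s hs => hs.1)
    (by
      rintro s ⟨-, S, hS, r, T, hT, u, hu, hsu⟩ t hts ht
      exact ⟨ht, S, hS, r, T, hT, u, hu, (Finset.coe_subset.2 hts).trans hsu⟩)
    (uniqueWeights_Z_faces hρ hlt)
  have hedge : ∀ m ∈ K'.vertices,
      ∃ p q, OrderedFaces.IsEdge ⟨K.faces, lt⟩ p q ∧ m = midpoint ℝ p q := by
    intro m hm
    obtain ⟨S, hS, Q, hQ, hmQ⟩ := exists_isPairChain_of_mem_Z_faces hlt hm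
    have : m ∈ (({m} : Finset E) : Set E) := by simp
    rw [hmQ] at this
    obtain ⟨p, hp, rfl⟩ := this
    exact ⟨p.1, p.2, isEdge_of_mem hρ hlt hS (hQ.mem p hp).1 (hQ.mem p hp).2
      (hQ.fst_le_snd p hp p hp), rfl⟩
  refine ⟨K', rfl, fun m hm => ?_, fun m hm m' hm' m'' hm'' => ?_, fun m hm m' hm' hne => ?_⟩
  · obtain ⟨p, q, h, rfl⟩ := hedge m hm
    rw [Z_lt_midpoint_iff hρ hlt h h]
    exact lt_irrefl _
  · obtain ⟨p, q, h, rfl⟩ := hedge m hm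
    obtain ⟨p', q', h', rfl⟩ := hedge m' hm'
    obtain ⟨p'', q'', h'', rfl⟩ := hedge m'' hm''
    rw [Z_lt_midpoint_iff hρ hlt h h', Z_lt_midpoint_iff hρ hlt h' h'',
      Z_lt_midpoint_iff hρ hlt h h'']
    exact lt_trans
  · obtain ⟨p, q, h, rfl⟩ := hedge m hm
    obtain ⟨p', q', h', rfl⟩ := hedge m' hm'
    rw [Z_lt_midpoint_iff hρ hlt h h', Z_lt_midpoint_iff hρ hlt h' h]
    refine lt_or_gt_of_ne fun heq => hne ?_
    obtain ⟨S, hS, hc⟩ := isPairChain_of_isEdge hlt h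
    obtain ⟨S', hS', hc'⟩ := isPairChain_of_isEdge hlt h'
    have hv := hc.mem (p, q) (by simp)
    have hv' := hc'.mem (p', q') (by simp)
    obtain ⟨h1, h2⟩ := Prod.mk.inj (toLex.injective heq)
    exact congrArg₂ (midpoint ℝ)
      (hρ (mem_vertices_of_mem hS hv.1) (mem_vertices_of_mem hS' hv'.1) h1)
      (hρ (mem_vertices_of_mem hS hv.2) (mem_vertices_of_mem hS' hv'.2) h2)

/-- A cell lists its own vertices in the order of the subdivision. -/
theorem lists_Z_of_mem_cells [DecidableEq E] (hfin : K.faces.Finite)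
    (hlin : LinearOn lt K.vertices) {S : Finset E} (hS : S ∈ K.faces) {r : ℕ}
    {T t : Fin (r + 1) → E} (hT : Lists lt S T) (ht : t ∈ cells T) :
    Lists (Z ⟨K.faces, lt⟩).lt (Finset.univ.image t) t := by
  have hV := finite_vertices hfin
  obtain ⟨ρ, hρ, hlt⟩ := hlin.exists_rank hV
  obtain ⟨i, j, -, -, hij, hstrict, hval⟩ := exists_path_of_mem_cells ht
  have hmono := hT.strictMono hlt hS
  have hedge (m) : OrderedFaces.IsEdge ⟨K.faces, lt⟩ (T (i m)) (T (j m)) :=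
    isEdge_of_mem hρ hlt hS (hT.mem _) (hT.mem _) (hmono.monotone (hij m m))
  refine ⟨fun m n hmn => ?_, by simp⟩
  rw [hval, hval, Z_lt_midpoint_iff hρ hlt (hedge m) (hedge n), Prod.Lex.toLex_lt_toLex]
  rcases hstrict m n hmn with h | ⟨h1, h2⟩
  · exact Or.inl (hmono h)
  · exact Or.inr ⟨congrArg (fun k => ρ (T k)) h1, hmono h2⟩

theorem image_mem_Z_faces [DecidableEq E] {S : Finset E} (hS : S ∈ K.faces) {r : ℕ}
    {T t : Fin (r + 1) → E} (hT : Lists lt S T) (ht : t ∈ cells T) :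
    Finset.univ.image t ∈ (Z ⟨K.faces, lt⟩).faces :=
  ⟨by simp, S, hS, r, T, hT, t, ht, by simp⟩

theorem convexHull_range_cell_subset {r : ℕ} {T t : Fin (r + 1) → E} (ht : t ∈ cells T) :
    convexHull ℝ (Set.range t) ⊆ convexHull ℝ (Set.range T) := by
  obtain ⟨i, j, -, -, -, -, hval⟩ := exists_path_of_mem_cells ht
  refine convexHull_min ?_ (convex_convexHull _ _)
  rintro _ ⟨m, rfl⟩
  rw [hval]
  exact (convex_convexHull ℝ _).midpoint_mem (subset_convexHull _ _ (Set.mem_range_self _))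
    (subset_convexHull _ _ (Set.mem_range_self _))

theorem exists_lists_of_mem_faces (hlin : LinearOn lt K.vertices) {S : Finset E}
    (hS : S ∈ K.faces) : ∃ (r : ℕ) (T : Fin (r + 1) → E), Lists lt S T := by
  have hpos := Finset.card_pos.2 (K.nonempty_of_mem_faces hS)
  exact ⟨S.card - 1, (hlin.mono (coe_subset_vertices hS)).exists_lists (by omega)⟩

theorem isSubdivision_Z {K' : Geometry.SimplicialComplex ℝ E} (hlin : LinearOn lt K.vertices)
    (hK' : K'.faces = (Z ⟨K.faces, lt⟩).faces) : IsSubdivision K' K := by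
  classical
  constructor
  · intro s hs
    rw [hK'] at hs
    obtain ⟨-, S, hS, r, T, hT, t, ht, hst⟩ := hs
    refine ⟨S, hS, (convexHull_mono hst).trans ?_⟩
    rw [← hT.2]
    exact convexHull_range_cell_subset ht
  · intro S hS
    obtain ⟨r, T, hT⟩ := exists_lists_of_mem_faces hlin hS
    refine Set.Subset.antisymm (fun x hx => ?_) (Set.iUnion₂_subset fun s hs => hs.2)
    rw [← hT.2] at hx
    obtain ⟨t, ht, hxt⟩ := exists_cell_of_mem_convexHull hx
    refine Set.mem_iUnion₂.2 ⟨Finset.univ.image t, ⟨hK' ▸ image_mem_Z_faces hS hT ht, ?_⟩, ?_⟩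
    · simpa [← hT.2] using convexHull_range_cell_subset ht
    · simpa using hxt

end Step

/-! ### Similarity to a conjugate -/

/-- A cell of a homothetic copy of a conjugate of `U` is again a homothetic copy of a conjugate
of `U`, since its edge vectors are the halved ones in another order. -/
theorem exists_eq_add_smul_conjugate_of_mem_cells {r : ℕ} {T U t : Fin (r + 1) → E}
    {π : Equiv.Perm (Fin r)} {a : E} {c : ℝ} (hT : ∀ i, T i = a + c • conjugate U π i)
    (ht : t ∈ cells T) :
    ∃ (π' : Equiv.Perm (Fin r)) (b : E), ∀ i, t i = b + (c / 2) • conjugate U π' i := by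
  obtain ⟨σ, τ, -, rfl⟩ := ht
  refine ⟨τ.trans π, conjugate (halfSimplex T σ) τ 0 - (c / 2) • U 0, fun i => ?_⟩
  have hedge (ν : Fin r) : edgeVec T ν = c • edgeVec U (π ν) := by
    rw [← edgeVec_conjugate, edgeVec, edgeVec, hT, hT]
    module
  rw [eq_add_sum_edgeVec (conjugate (halfSimplex T σ) τ) i, conjugate.eq_def U]
  simp only [edgeVec_conjugate, edgeVec_halfSimplex, hedge, smul_add, Finset.smul_sum, smul_smul,
    Equiv.trans_apply]
  rw [← add_assoc, sub_add_cancel]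
  congr 1
  refine Finset.sum_congr rfl fun ν _ => ?_
  congr 1
  ring

theorem similar_of_eq_add_smul {ι : Type*} {t u : ι → E} {a : E} {c : ℝ} (hc : c ≠ 0)
    (h : ∀ i, t i = a + c • u i) : Similar t u := by
  refine ⟨‖c‖₊, by simpa using hc, fun i j => ?_⟩
  rw [h, h, edist_add_left, edist_smul₀, ENNReal.smul_def, smul_eq_mul]

/-- The sequence `K` of simplicial complexes with vertex orders `ord` arises by iterating `Z`. -/
structure IsIteration (K : ℕ → Geometry.SimplicialComplex ℝ E) (ord : ℕ → E → E → Prop) :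
    Prop where
  faces_succ : ∀ k, (K (k + 1)).faces = (Z ⟨(K k).faces, ord k⟩).faces
  ord_succ : ∀ k, ord (k + 1) = (Z ⟨(K k).faces, ord k⟩).lt
  finite : ∀ k, (K k).faces.Finite
  linearOn : ∀ k, LinearOn (ord k) (K k).vertices

namespace IsIteration

variable {K : ℕ → Geometry.SimplicialComplex ℝ E} {ord : ℕ → E → E → Prop}

theorem isSubdivision (h : IsIteration K ord) (k : ℕ) : IsSubdivision (K (k + 1)) (K k) :=
  isSubdivision_Z (h.linearOn k) (h.faces_succ k)

theorem card_eq (h : IsIteration K ord) {k : ℕ} {s : Finset E} (hs : s ∈ (K k).faces) {r : ℕ}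
    {T : Fin (r + 1) → E} (hT : Lists (ord k) s T) : s.card = r + 1 :=
  hT.card_eq ((h.linearOn k).mono (coe_subset_vertices hs))

/-- Every point of a simplex lies in a cell of that simplex. -/
theorem exists_cell [DecidableEq E] (h : IsIteration K ord) {k : ℕ} {S : Finset E}
    (hS : S ∈ (K k).faces) {r : ℕ} {T : Fin (r + 1) → E} (hT : Lists (ord k) S T) {x : E}
    (hx : x ∈ convexHull ℝ (S : Set E)) :
    ∃ t ∈ cells T, Lists (ord (k + 1)) (Finset.univ.image t) t ∧
      Finset.univ.image t ∈ (K (k + 1)).faces ∧ (Finset.univ.image t).card = S.card ∧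
      x ∈ convexHull ℝ ((Finset.univ.image t : Finset E) : Set E) ∧
      convexHull ℝ ((Finset.univ.image t : Finset E) : Set E) ⊆ convexHull ℝ (S : Set E) := by
  rw [← hT.2] at hx
  obtain ⟨t, ht, hxt⟩ := exists_cell_of_mem_convexHull hx
  have hl := lists_Z_of_mem_cells (h.finite k) (h.linearOn k) hS hT ht
  rw [← h.ord_succ] at hl
  have hmem := image_mem_Z_faces hS hT ht
  rw [← h.faces_succ] at hmem
  refine ⟨t, ht, hl, hmem, ?_, by simpa using hxt, ?_⟩
  · rw [h.card_eq hmem hl, h.card_eq hS hT]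
  · simpa [← hT.2] using convexHull_range_cell_subset ht

/-- An inner point of `s` lies in some cell of the simplex of full dimension given by the induction
hypothesis, and `s` is a face of that cell. -/
theorem exists_face_full_dim (h : IsIteration K ord) (k : ℕ) :
    ∀ s ∈ (K k).faces, ∃ s' ∈ (K k).faces, s ⊆ s' ∧ ∃ S ∈ (K 0).faces,
      s'.card = S.card ∧ convexHull ℝ (s' : Set E) ⊆ convexHull ℝ (S : Set E) := by
  classical
  induction k with
  | zero => exact fun s hs => ⟨s, hs, subset_rfl, s, hs, rfl, subset_rfl⟩
  | succ k ih =>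
    intro s hs
    obtain ⟨x, hx, hxs⟩ := exists_mem_convexHull_forall_subset _ hs
    obtain ⟨S, hS, hsS⟩ := (h.isSubdivision k).1 s hs
    obtain ⟨S', hS', hSS', S₀, hS₀, hcard, hsub⟩ := ih S hS
    obtain ⟨r, T, hT⟩ := exists_lists_of_mem_faces (h.linearOn k) hS'
    obtain ⟨t, -, -, htK, htc, hxt, htS⟩ := h.exists_cell hS' hT
      (convexHull_mono (Finset.coe_subset.2 hSS') (hsS hx))
    exact ⟨_, htK, hxs _ htK hxt, S₀, hS₀, htc.trans hcard, htS.trans hsub⟩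

/-- The simplices of `K k` that lie in a simplex `S` of the first complex cover `S`. -/
theorem exists_face_mem (h : IsIteration K ord) {S : Finset E} (hS : S ∈ (K 0).faces) {x : E}
    (hx : x ∈ convexHull ℝ (S : Set E)) (k : ℕ) :
    ∃ s ∈ (K k).faces, convexHull ℝ (s : Set E) ⊆ convexHull ℝ (S : Set E) ∧
      x ∈ convexHull ℝ (s : Set E) := by
  induction k with
  | zero => exact ⟨S, hS, subset_rfl, hx⟩
  | succ k ih =>
    obtain ⟨s, hs, hsS, hxs⟩ := ih
    rw [(h.isSubdivision k).2 s hs] at hxs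
    obtain ⟨t, ht, hxt⟩ := Set.mem_iUnion₂.1 hxs
    exact ⟨t, ht.1, ht.2.trans hsS, hxt⟩

/-- A simplex of full dimension in a simplex `S` of the first complex is a homothetic copy of a
conjugate of `S`: by a dimension count it is a cell of a simplex of full dimension in `S`. -/
theorem exists_eq_add_smul_conjugate (h : IsIteration K ord) (k : ℕ) :
    ∀ s ∈ (K k).faces, ∀ S ∈ (K 0).faces, s.card = S.card →
      convexHull ℝ (s : Set E) ⊆ convexHull ℝ (S : Set E) →
      ∃ (r : ℕ) (t T : Fin (r + 1) → E) (π : Equiv.Perm (Fin r)) (a : E),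
        Lists (ord k) s t ∧ Lists (ord 0) S T ∧
        ∀ i, t i = a + ((1 / 2 : ℝ) ^ k) • conjugate T π i := by
  classical
  induction k with
  | zero =>
    intro s hs S hS hcard hsub
    obtain rfl : s = S := Finset.eq_of_subset_of_card_le
      (((K 0).face_subset_face_iff hs hS).1 hsub) hcard.ge
    obtain ⟨r, T, hT⟩ := exists_lists_of_mem_faces (h.linearOn 0) hs
    refine ⟨r, T, T, 1, 0, hT, hT, fun i => ?_⟩
    rw [pow_zero, one_smul, zero_add]
    exact eq_add_sum_edgeVec T i
  | succ k ih =>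
    intro s hs S hS hcard hsub
    obtain ⟨x, hx, hxs⟩ := exists_mem_convexHull_forall_subset _ hs
    obtain ⟨u, hu, huS, hxu⟩ := h.exists_face_mem hS (hsub hx) k
    have hu_card : u.card ≤ S.card :=
      ((K k).indep hu).card_le_card_of_subset_affineSpan
        (((subset_convexHull ℝ _).trans huS).trans (convexHull_subset_affineSpan _))
    have hsu : s.card ≤ u.card := by
      obtain ⟨r, T, hT⟩ := exists_lists_of_mem_faces (h.linearOn k) hu
      obtain ⟨t, -, -, htK, htc, hxt, -⟩ := h.exists_cell hu hT hxu
      exact htc ▸ Finset.card_le_card (hxs _ htK hxt)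
    obtain ⟨r, T, U, π, a, hT, hU, hTU⟩ := ih u hu S hS (by omega) huS
    obtain ⟨t, ht, htl, htK, htc, hxt, -⟩ := h.exists_cell hu hT hxu
    obtain rfl : s = Finset.univ.image t :=
      Finset.eq_of_subset_of_card_le (hxs _ htK hxt) (by omega)
    obtain ⟨π', b, hb⟩ := exists_eq_add_smul_conjugate_of_mem_cells hTU ht
    refine ⟨r, t, U, π', b, htl, hU, fun i => ?_⟩
    rw [hb, pow_succ, mul_one_div]

end IsIteration

theorem exists_isIteration (R : Geometry.SimplicialComplex ℝ E) (hfin : R.faces.Finite)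
    (lt : E → E → Prop) (hlt : LinearOn lt R.vertices) :
    ∃ (K : ℕ → Geometry.SimplicialComplex ℝ E) (ord : ℕ → E → E → Prop),
      K 0 = R ∧ ord 0 = lt ∧ (∀ k, Z^[k] ⟨R.faces, lt⟩ = ⟨(K k).faces, ord k⟩) ∧
      IsIteration K ord := by
  have key (k : ℕ) : ∃ K' : Geometry.SimplicialComplex ℝ E,
      K'.faces = (Z^[k] ⟨R.faces, lt⟩).faces ∧ K'.faces.Finite ∧
      LinearOn (Z^[k] ⟨R.faces, lt⟩).lt K'.vertices := by
    induction k with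
    | zero => exact ⟨R, rfl, hfin, hlt⟩
    | succ k ih =>
      obtain ⟨K', hK', hfin', hlin'⟩ := ih
      obtain ⟨K'', hK'', hlin''⟩ := exists_complex_Z hfin' hlin'
      rw [Function.iterate_succ_apply']
      have : Z^[k] ⟨R.faces, lt⟩ = ⟨K'.faces, (Z^[k] ⟨R.faces, lt⟩).lt⟩ := by rw [hK']
      rw [← this] at hK'' hlin''
      exact ⟨K'', hK'', by rw [hK'', this]; exact finite_Z_faces hfin', hlin''⟩
  choose K hK hKfin hKlin using key
  have heq (k : ℕ) : Z^[k] ⟨R.faces, lt⟩ = ⟨(K k).faces, (Z^[k] ⟨R.faces, lt⟩).lt⟩ := by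
    rw [hK k]
  refine ⟨K, fun k => (Z^[k] ⟨R.faces, lt⟩).lt, Geometry.SimplicialComplex.ext (hK 0), rfl, heq,
    ⟨fun k => ?_, fun k => ?_, hKfin, hKlin⟩⟩
  · rw [← heq, hK, Function.iterate_succ_apply']
  · rw [← heq, Function.iterate_succ_apply']

/-! ### Volume and diameter -/

section Volume

open scoped Pointwise

theorem convexHull_image_add_smul [DecidableEq E] (s : Finset E) (a : E) (c : ℝ) :
    convexHull ℝ ((s.image fun v => a + c • v : Finset E) : Set E) =
      a +ᵥ c • convexHull ℝ (s : Set E) := by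
  rw [← convexHull_smul, ← convexHull_vadd]
  congr 1
  ext v
  simp [Set.mem_vadd_set, Set.mem_smul_set]

variable [MeasurableSpace E] [BorelSpace E]

/-- Since `simplexVolume` takes a real value, this says that the measure is positive and finite. -/
theorem simplexVolume_pos {s : Finset E} (hs : AffineIndependent ℝ ((↑) : s → E)) {r : ℕ}
    (hr : s.card = r + 1) : 0 < simplexVolume r s := by
  obtain ⟨p, hp⟩ : s.Nonempty := Finset.card_pos.1 (by omega)
  -- the simplex is an isometric copy of a simplex with interior points in its direction space
  let V := vectorSpan ℝ (s : Set E)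
  have hV : Module.finrank ℝ V = r := by
    have h1 := hs.finrank_vectorSpan (n := r) (by simpa using hr)
    rwa [show Set.range ((↑) : s → E) = (s : Set E) from Subtype.range_coe] at h1
  have : FiniteDimensional ℝ V := finiteDimensional_vectorSpan_of_finite ℝ s.finite_toSet
  let q (v : s) : V := ⟨(v : E) - p, vsub_mem_vectorSpan ℝ v.2 hp⟩
  let g : V →ᵃ[ℝ] E := V.subtype.toAffineMap + AffineMap.const ℝ V p
  have hg (v : V) : g v = v + p := rfl
  have hgq : (g ∘ q : s → E) = (↑) := by
    ext v
    simp [hg, q]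
  have hq : AffineIndependent ℝ q := AffineIndependent.of_comp g (by rw [hgq]; exact hs)
  have hspan : affineSpan ℝ (Set.range q) = ⊤ := by
    rw [hq.affineSpan_eq_top_iff_card_eq_finrank_add_one, hV]
    simpa using hr
  have himage : g '' convexHull ℝ (Set.range q) = convexHull ℝ (s : Set E) := by
    rw [AffineMap.image_convexHull, ← Set.range_comp, hgq]
    congr 1
    exact Subtype.range_coe
  have hiso : Isometry g := Isometry.of_dist_eq fun v w => by
    rw [hg, hg, dist_add_right]
    rfl
  rw [simplexVolume, ← himage, hiso.euclideanHausdorffMeasure_image, ← hV, ENNReal.toReal_pos_iff]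
  constructor
  · exact ((isOpen_interior.measure_pos _
      (interior_convexHull_nonempty_iff_affineSpan_eq_top.2 hspan))).trans_le
        (measure_mono interior_subset)
  · exact ((Set.finite_range q).isCompact_convexHull ℝ).measure_lt_top

/-- The flatness of a simplex is invariant under homotheties and translations. -/
theorem simplexDiam_pow_div_simplexVolume_image [DecidableEq E] (s : Finset E) (a : E) {c : ℝ}
    (hc : 0 < c) (r : ℕ) :
    simplexDiam (s.image fun v => a + c • v) ^ r / simplexVolume r (s.image fun v => a + c • v) =
      simplexDiam s ^ r / simplexVolume r s := by
  have hd : simplexDiam (s.image fun v => a + c • v) = c * simplexDiam s := by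
    rw [simplexDiam, convexHull_image_add_smul, diam_vadd, diam_smul₀,
      Real.norm_of_nonneg hc.le]
    rfl
  have hv : simplexVolume r (s.image fun v => a + c • v) = c ^ r * simplexVolume r s := by
    rw [simplexVolume, convexHull_image_add_smul, measure_vadd,
      Measure.euclideanHausdorffMeasure_smul₀ r hc.ne', ENNReal.smul_def, smul_eq_mul,
      ENNReal.toReal_mul, ENNReal.coe_toReal, NNReal.coe_pow, coe_nnnorm,
      Real.norm_of_nonneg hc.le]
    rfl
  rw [hd, hv, mul_pow, mul_div_mul_left _ _ (pow_pos hc r).ne']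

/-- Up to translation and scaling only finitely many simplices occur, the faces of the conjugates
of the simplices of the first complex. -/
theorem IsIteration.exists_flatness_le {K : ℕ → Geometry.SimplicialComplex ℝ E}
    {ord : ℕ → E → E → Prop} (h : IsIteration K ord) :
    ∃ C : ℝ, ∀ k, ∀ s ∈ (K k).faces, ∀ r : ℕ, s.card = r + 1 →
      simplexDiam s ^ r / simplexVolume r s ≤ C := by
  classical
  let f (s : Finset E) : ℝ := simplexDiam s ^ (s.card - 1) / simplexVolume (s.card - 1) s
  have hfin : (⋃ S ∈ (K 0).faces,
      ⋃ T ∈ {T : Fin (S.card - 1 + 1) → E | ∀ i, T i ∈ (S : Set E)},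
      ⋃ π : Equiv.Perm (Fin (S.card - 1)), ⋃ A : Finset (Fin (S.card - 1 + 1)),
        {f (A.image (conjugate T π))}).Finite :=
    (h.finite 0).biUnion fun S _ => (Set.Finite.pi' fun _ => S.finite_toSet).biUnion fun T _ =>
      Set.finite_iUnion fun π => Set.finite_iUnion fun A => Set.finite_singleton _
  obtain ⟨C, hC⟩ := hfin.bddAbove
  refine ⟨C, fun k s hs r hr => ?_⟩
  obtain ⟨s', hs', hss', S, hS, hcard, hsub⟩ := h.exists_face_full_dim k s hs
  obtain ⟨n, t, T, π, a, ht, hT, htT⟩ := h.exists_eq_add_smul_conjugate k s' hs' S hS hcard hsub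
  obtain rfl : n = S.card - 1 := by rw [h.card_eq hS hT, Nat.add_sub_cancel]
  have hpos : (0 : ℝ) < (1 / 2) ^ k := by positivity
  let A : Finset (Fin (S.card - 1 + 1)) := {i | t i ∈ s}
  have hsA : s = (A.image (conjugate T π)).image fun v => a + ((1 / 2 : ℝ) ^ k) • v := by
    ext v
    simp only [A, Finset.mem_image, Finset.mem_filter, Finset.mem_univ, true_and,
      exists_exists_and_eq_and, ← htT]
    constructor
    · intro hv
      have hv' : v ∈ Set.range t := by
        rw [ht.2]
        exact hss' hv
      obtain ⟨i, rfl⟩ := hv'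
      exact ⟨i, hv, rfl⟩
    · rintro ⟨i, hi, rfl⟩
      exact hi
  have hinj : Function.Injective fun v : E => a + ((1 / 2 : ℝ) ^ k) • v := fun v w hvw =>
    smul_right_injective E hpos.ne' (add_left_cancel hvw)
  have hcardA : (A.image (conjugate T π)).card = r + 1 := by
    rw [← hr]
    conv_rhs => rw [hsA]
    rw [Finset.card_image_of_injective _ hinj]
  rw [hsA, simplexDiam_pow_div_simplexVolume_image _ _ hpos]
  have : simplexDiam (A.image (conjugate T π)) ^ r / simplexVolume r (A.image (conjugate T π)) =
      f (A.image (conjugate T π)) := by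
    simp only [f, hcardA, Nat.add_sub_cancel]
  rw [this]
  refine hC ?_
  simp only [Set.mem_iUnion]
  exact ⟨S, hS, T, fun i => hT.mem i, π, A, rfl⟩

end Volume

end FreudenthalSubdivision

theorem mainTheorem1 {E : Type*} [NormedAddCommGroup E] [InnerProductSpace ℝ E]
    [MeasurableSpace E] [BorelSpace E]
    (R : Geometry.SimplicialComplex ℝ E) (hfin : R.faces.Finite)
    (lt : E → E → Prop) (hlt : FreudenthalSubdivision.LinearOn lt R.vertices) :
    ∃ (K : ℕ → Geometry.SimplicialComplex ℝ E) (ord : ℕ → E → E → Prop),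
      -- `K k` with the vertex order `ord k` is the result of `k` applications of `Z`
      (∀ k, FreudenthalSubdivision.Z^[k] ⟨R.faces, lt⟩ = ⟨(K k).faces, ord k⟩) ∧
      (∀ k, (K k).faces.Finite ∧ FreudenthalSubdivision.LinearOn (ord k) (K k).vertices) ∧
      -- nested sequence of subdivisions
      (∀ k, FreudenthalSubdivision.IsSubdivision (K (k + 1)) (K k)) ∧
      -- every simplex is a face of one that has full dimension in a simplex of `R`
      (∀ k, ∀ s ∈ (K k).faces, ∃ s' ∈ (K k).faces, s ⊆ s' ∧ ∃ S ∈ R.faces,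
        s'.card = S.card ∧ convexHull ℝ (s' : Set E) ⊆ convexHull ℝ (S : Set E)) ∧
      -- those that have full dimension in a simplex of `R` are similar to a conjugate of it
      (∀ k, ∀ s ∈ (K k).faces, ∀ S ∈ R.faces, s.card = S.card →
        convexHull ℝ (s : Set E) ⊆ convexHull ℝ (S : Set E) →
        FreudenthalSubdivision.SimilarToConjugate (ord k) s lt S) ∧
      -- the flatness is uniformly bounded
      (∃ C : ℝ, ∀ k, ∀ s ∈ (K k).faces, ∀ r : ℕ, s.card = r + 1 →
        0 < FreudenthalSubdivision.simplexVolume r s ∧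
        FreudenthalSubdivision.simplexDiam s ^ r / FreudenthalSubdivision.simplexVolume r s
          ≤ C) := by
  obtain ⟨K, ord, rfl, rfl, hK, h⟩ :=
    FreudenthalSubdivision.exists_isIteration R hfin lt hlt
  refine ⟨K, ord, hK, fun k => ⟨h.finite k, h.linearOn k⟩, h.isSubdivision,
    h.exists_face_full_dim, fun k s hs S hS hcard hsub => ?_, ?_⟩
  · obtain ⟨r, t, T, π, a, ht, hT, htT⟩ := h.exists_eq_add_smul_conjugate k s hs S hS hcard hsub
    exact ⟨r, t, T, π, ht, hT,
      FreudenthalSubdivision.similar_of_eq_add_smul (by positivity) htT⟩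
  · obtain ⟨C, hC⟩ := h.exists_flatness_le
    exact ⟨C, fun k s hs r hr =>
      ⟨FreudenthalSubdivision.simplexVolume_pos ((K k).indep hs) hr, hC k s hs r hr⟩⟩
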